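/- Let $G$ be a compact Lie group and let $\Sigma$ be a smooth $G$-cone with compact base $X$: that is, $X$ is a compact (finite-dimensional, Hausdorff) smooth manifold, possibly with boundary, $\Sigma\to X$ is a smooth principal bundle for the multiplicative group $\mathbb{R}_{>0}$ (whose action on $\Sigma$, $(t,x)\mapsto t\cdot x$, is called the action by homotheties), and $G$ acts smoothly on $\Sigma$ and commutes with homotheties. Let $\rho$ be the radial vector field $\rho(x)=\frac{d}{dt}\big|_{t=1}\,t\cdot x$. Let $\lambda$ be a smooth real $G$-invariant 1-form on $\Sigma$ which is horizontal and homogeneous of degree 1, i.e. $\rho\lrcorner\lambda=0$ and $L_\rho\lambda=\lambda$. Then there exist a finite-dimensional continuous real orthogonal representation $V\cong\mathbb{R}^n$ of $G$ and a smooth embedding $z:\Sigma\to V^c\cong\mathbb{C}^n$ into its complexification $V^c=V\otimes_{\mathbb{R}}\mathbb{C}$ (a unitary representation of $G$) such that $z$ is $G$-equivariant, $z(g\cdot x)=g\,z(x)$ for all $g\in G$; $z$ is homogeneous of degree $\tfrac12$, $z(t\cdot x)=t^{1/2}z(x)$ for all $t>0$; and $$\lambda=\operatorname{Im}\,\bar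 z\cdot dz=\operatorname{Im}\sum_{j=1}^n\bar z_j\,dz_j .$$ -/

import Mathlib

open Set Topology
open scoped Manifold ContDiff Bundle

noncomputable section

/-- A smooth cone `S` with base `X`: a smooth principal bundle `S → X` for the multiplicative group
of positive real numbers. `dil t` is the homothety of ratio `t`; its values for `t ≤ 0` are
irrelevant. The last field is smooth equivariant local triviality: near every point of the base the
bundle is `U × (0, ∞)` with homotheties acting by multiplication on the second factor. -/
structure SmoothCone
    {ES : Type*} [NormedAddCommGroup ES] [NormedSpace ℝ ES] {HS : Type*} [TopologicalSpace HS]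
    (IS : ModelWithCorners ℝ ES HS)
    {EX : Type*} [NormedAddCommGroup EX] [NormedSpace ℝ EX] {HX : Type*} [TopologicalSpace HX]
    (IX : ModelWithCorners ℝ EX HX)
    (S : Type*) [TopologicalSpace S] [ChartedSpace HS S]
    (X : Type*) [TopologicalSpace X] [ChartedSpace HX X] where
  proj : S → X
  dil : ℝ → S → S
  contMDiff_proj : ContMDiff IS IX ∞ proj
  contMDiffOn_dil : ContMDiffOn (𝓘(ℝ, ℝ).prod IS) IS ∞ (fun q : ℝ × S => dil q.1 q.2)
    (Ioi 0 ×ˢ univ)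
  dil_one : ∀ x, dil 1 x = x
  dil_mul : ∀ s t, 0 < s → 0 < t → ∀ x, dil (s * t) x = dil s (dil t x)
  proj_dil : ∀ t, 0 < t → ∀ x, proj (dil t x) = proj x
  exists_trivialization : ∀ b : X, ∃ (U : Set X) (φ : OpenPartialHomeomorph S (X × ℝ)),
    IsOpen U ∧ b ∈ U ∧ φ.source = proj ⁻¹' U ∧ φ.target = U ×ˢ Ioi 0 ∧
    ContMDiffOn IS (IX.prod 𝓘(ℝ, ℝ)) ∞ φ φ.source ∧
    ContMDiffOn (IX.prod 𝓘(ℝ, ℝ)) IS ∞ φ.symm φ.target ∧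
    ∀ x ∈ φ.source, (φ x).1 = proj x ∧ ∀ t, 0 < t → φ (dil t x) = (proj x, t * (φ x).2)

/-- Smooth real 1-forms on `S`: smooth sections of the cotangent bundle. -/
abbrev SmoothOneForm
    {ES : Type*} [NormedAddCommGroup ES] [NormedSpace ℝ ES] {HS : Type*} [TopologicalSpace HS]
    (IS : ModelWithCorners ℝ ES HS)
    (S : Type*) [TopologicalSpace S] [ChartedSpace HS S] [IsManifold IS ∞ S] :=
  ContMDiffSection IS (ES →L[ℝ] ℝ) ∞
    (fun x : S => TangentSpace IS x →L[ℝ] Bundle.Trivial S ℝ x)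

/-- The pullback `f^* w`, as a family of covectors, evaluated at `x` on the tangent vector `v`. -/
def pullbackOneForm
    {ES : Type*} [NormedAddCommGroup ES] [NormedSpace ℝ ES] {HS : Type*} [TopologicalSpace HS]
    {IS : ModelWithCorners ℝ ES HS}
    {S : Type*} [TopologicalSpace S] [ChartedSpace HS S] [IsManifold IS ∞ S]
    (f : S → S) (w : SmoothOneForm IS S) (x : S) (v : TangentSpace IS x) : ℝ :=
  w (f x) (mfderiv IS IS f x v)

namespace SmoothCone

variable
    {ES : Type*} [NormedAddCommGroup ES] [NormedSpace ℝ ES] {HS : Type*} [TopologicalSpace HS]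
    {IS : ModelWithCorners ℝ ES HS}
    {EX : Type*} [NormedAddCommGroup EX] [NormedSpace ℝ EX] {HX : Type*} [TopologicalSpace HX]
    {IX : ModelWithCorners ℝ EX HX}
    {S : Type*} [TopologicalSpace S] [ChartedSpace HS S]
    {X : Type*} [TopologicalSpace X] [ChartedSpace HX X]

/-- The radial vector field `ρ`: the velocity at `t = 1` of `t ↦ dil t x`. (This velocity is a
tangent vector at `dil 1 x`, which is the point `x`.) -/
def radialField (C : SmoothCone IS IX S X) (x : S) : TangentSpace IS x :=
  cast (congrArg (fun y : S => TangentSpace IS y) (C.dil_one x))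
    (mfderiv 𝓘(ℝ, ℝ) IS (fun t : ℝ => C.dil t x) 1 (1 : ℝ))

variable [IsManifold IS ∞ S]

/-- A 1-form is horizontal if its contraction with the radial vector field vanishes. -/
def IsHorizontal (C : SmoothCone IS IX S X) (w : SmoothOneForm IS S) : Prop :=
  ∀ x : S, w x (C.radialField x) = 0

/-- `L_ρ w = η`, where `L_ρ` is the Lie derivative along the radial vector field `ρ`, i.e. the
derivative at time `0` of the pullback under the flow of `ρ`, which is `s ↦ dil (exp s)`. -/
def HasRadialLieDeriv (C : SmoothCone IS IX S X) (w η : SmoothOneForm IS S) : Prop :=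
  ∀ (x : S) (v : TangentSpace IS x),
    HasDerivAt (fun s : ℝ => pullbackOneForm (C.dil (Real.exp s)) w x v) (η x v) 0

end SmoothCone

/-- The complexification of a real orthogonal representation on `ℝⁿ` (in matrix form): the same
matrices, acting unitarily on `ℂⁿ`. -/
def complexifyRep {G : Type*} [Group G] {n : ℕ} (rep : G →* Matrix.orthogonalGroup (Fin n) ℝ) :
    G →* Matrix.unitaryGroup (Fin n) ℂ where
  toFun g := ⟨(rep g : Matrix (Fin n) (Fin n) ℝ).map Complex.ofReal, by
    have h := (Matrix.mem_orthogonalGroup_iff (Fin n) ℝ).1 (rep g).2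
    rw [Matrix.mem_unitaryGroup_iff]
    have h2 : star ((rep g : Matrix (Fin n) (Fin n) ℝ).map Complex.ofReal)
        = (star (rep g : Matrix (Fin n) (Fin n) ℝ)).map Complex.ofReal := by
      ext i j; simp [Matrix.star_apply]
    rw [h2]
    have h3 := congrArg (fun M : Matrix (Fin n) (Fin n) ℝ => Complex.ofRealHom.mapMatrix M) h
    simp only [map_mul, map_one] at h3
    exact h3⟩
  map_one' := by
    ext i j; simp [Matrix.one_apply, apply_ite Complex.ofReal]
  map_mul' g h := by
    apply Subtype.ext
    rw [map_mul]
    exact Complex.ofRealHom.mapMatrix.map_mul (rep g : Matrix (Fin n) (Fin n) ℝ) (rep h).1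

/-- A smooth embedding of a manifold `S` into a finite-dimensional real normed space: a smooth map
that is a homeomorphism onto its image and whose differential is injective at every point. -/
def IsSmoothEmbeddingInto
    {ES : Type*} [NormedAddCommGroup ES] [NormedSpace ℝ ES] {HS : Type*} [TopologicalSpace HS]
    (IS : ModelWithCorners ℝ ES HS)
    {S : Type*} [TopologicalSpace S] [ChartedSpace HS S]
    {V : Type*} [NormedAddCommGroup V] [NormedSpace ℝ V] (z : S → V) : Prop :=
  ContMDiff IS 𝓘(ℝ, V) ∞ z ∧ IsEmbedding z ∧ ∀ x, Function.Injective (mfderiv IS 𝓘(ℝ, V) z x)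

/-- The value at `x` on `v` of the 1-form `Im z̄ · dz`, where `z` maps `S` to `ℂⁿ`. -/
def imConjDot
    {ES : Type*} [NormedAddCommGroup ES] [NormedSpace ℝ ES] {HS : Type*} [TopologicalSpace HS]
    (IS : ModelWithCorners ℝ ES HS)
    {S : Type*} [TopologicalSpace S] [ChartedSpace HS S] {n : ℕ}
    (z : S → EuclideanSpace ℂ (Fin n)) (x : S) (v : TangentSpace IS x) : ℝ :=
  let dz : EuclideanSpace ℂ (Fin n) := mfderiv IS 𝓘(ℝ, EuclideanSpace ℂ (Fin n)) z x v
  (∑ j, starRingEnd ℂ (z x j) * dz j).im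

end

/-! Write z = p + iq with p, q real. Then Im z̄·dz = p·dq − q·dp, and for p = √r u, q = √r v this is
r(u·dv − v·du), because the terms in d√r cancel. Suppose that r > 0 is invariant of degree 1 and λ =
r β·dw, with w and β equivariant of degree 0 into one orthogonal representation W. In W ⊕ ℝ, with
trivial second summand, take u = (β/√2, 1) and v = (w/√2, β·w/2). The first block contributes ½(β·dw
− w·dβ), the second ½ d(β·w), and the sum is β·dw. The last real part of z is √r, so z determines r
and w. If (r, w) is an injective immersion, so is z, and compactness of {r = 1} makes z a
homeomorphism onto its image (`exists_complex_embedding`).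

It remains to find r, w and β. The function r is patched from fibre coordinates over the compact
base and averaged over G. A Euclidean embedding of the base gives degree 0 functions f_a which form
an injective immersion together with r, but are not equivariant. They are replaced by orbit
integrals ∫ e(g) f_a(g⁻¹x) dg, with e in a finite-dimensional invariant subspace V of L²(G); these
transform by the representation on V. A weak Peter–Weyl theorem
(`exists_finiteDimensional_invariant_inner_ne_zero`) says that any nonzero function on G is detected
by some V, and compactness of {r = 1} makes a single V suffice
(`exists_equivariant_injective_immersion`).

As (r, w) is an immersion, λ = c dr + Σ bᵢ dwᵢ with smooth coefficients. Contraction with ρ gives c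
= 0, since λ and dw vanish on ρ while dr(ρ) = r. Homogeneity of λ allows b to have degree 1,
averaging over G makes b equivariant, and β = b/r. -/

set_option linter.unusedSectionVars false

/-! ### Peter–Weyl by averaging rank one operators -/

section PeterWeyl

open MeasureTheory InnerProductSpace

variable {G : Type*} [Group G] [TopologicalSpace G] [IsTopologicalGroup G] [CompactSpace G]
  [SecondCountableTopology G] [MeasurableSpace G] [BorelSpace G]
  {H : Type*} [NormedAddCommGroup H] [InnerProductSpace ℝ H] [CompleteSpace H]

/-- The average over the group of the rank one operators `|g • D⟩⟨g • D|`. -/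
noncomputable def averagedRankOne (μ : Measure G) (τ : G →* (H ≃ₗᵢ[ℝ] H)) (D : H) : H →L[ℝ] H :=
  ∫ g, rankOne ℝ (τ g D) (τ g D) ∂μ

variable (μ : Measure G) [IsProbabilityMeasure μ] (τ : G →* (H ≃ₗᵢ[ℝ] H))
  (hτ : ∀ u, Continuous fun g => τ g u) (D : H)

include hτ

theorem continuous_rankOne_orbit :
    Continuous fun g => rankOne ℝ (τ g D) (τ g D) :=
  ((rankOne ℝ (E := H) (F := H)).continuous.comp (hτ D)).clm_apply (hτ D)

theorem integrable_rankOne_orbit :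
    Integrable (fun g => rankOne ℝ (τ g D) (τ g D)) μ :=
  (continuous_rankOne_orbit τ hτ D).integrable_of_hasCompactSupport
    (HasCompactSupport.of_compactSpace _)

theorem averagedRankOne_apply (u : H) :
    averagedRankOne μ τ D u = ∫ g, inner ℝ (τ g D) u • τ g D ∂μ := by
  rw [averagedRankOne, ContinuousLinearMap.integral_apply (integrable_rankOne_orbit μ τ hτ D)]
  simp [rankOne_apply]

theorem inner_averagedRankOne (u v : H) :
    inner ℝ v (averagedRankOne μ τ D u) = ∫ g, inner ℝ (τ g D) u * inner ℝ (τ g D) v ∂μ := by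
  have hi : Integrable (fun g => inner ℝ (τ g D) u • τ g D) μ :=
    (((hτ D).inner continuous_const).smul (hτ D)).integrable_of_hasCompactSupport
      (HasCompactSupport.of_compactSpace _)
  rw [averagedRankOne_apply μ τ hτ, ← integral_inner hi]
  simp [inner_smul_right, real_inner_comm]

/-- Compact operators form a norm-closed convex set, which therefore contains the average of a
norm-continuous family of rank one operators against a probability measure. -/
theorem isCompactOperator_averagedRankOne : IsCompactOperator (averagedRankOne μ τ D) := by
  have hcl : IsClosed {f : H →L[ℝ] H | IsCompactOperator f} := isClosed_setOfPred_isCompactOperator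
  have hcv : Convex ℝ {f : H →L[ℝ] H | IsCompactOperator f} :=
    (compactOperator (RingHom.id ℝ) H H).convex
  refine hcv.integral_mem hcl (Filter.Eventually.of_forall fun g => ?_)
    (integrable_rankOne_orbit μ τ hτ D)
  have : (rankOne ℝ (τ g D) (τ g D) : H →L[ℝ] H)
      = (ContinuousLinearMap.toSpanSingleton ℝ (τ g D)).comp (innerSL ℝ (τ g D)) := by
    ext u; simp [rankOne_apply]
  simp only [mem_ofPred_eq, this]
  exact (isCompactOperator_of_locallyCompactSpace_rng
    (ContinuousLinearMap.toSpanSingleton ℝ (τ g D))).comp_clm _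

theorem averagedRankOne_equivariant [μ.IsMulLeftInvariant] (h : G) (u : H) :
    averagedRankOne μ τ D (τ h u) = τ h (averagedRankOne μ τ D u) := by
  rw [averagedRankOne_apply μ τ hτ, averagedRankOne_apply μ τ hτ,
    ← integral_mul_left_eq_self _ h]
  change _ = (τ h).toContinuousLinearEquiv.toContinuousLinearMap _
  rw [← ContinuousLinearMap.integral_comp_comm]
  · simp
  · exact (((hτ D).inner continuous_const).smul (hτ D)).integrable_of_hasCompactSupport
      (HasCompactSupport.of_compactSpace _)

/-- A nonzero vector of a strongly continuous isometric representation of a compact group is not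
orthogonal to all finite-dimensional invariant subspaces. -/
theorem exists_finiteDimensional_invariant_inner_ne_zero [μ.IsMulLeftInvariant]
    [μ.IsOpenPosMeasure] (hD : D ≠ 0) :
    ∃ V : Submodule ℝ H, FiniteDimensional ℝ V ∧ (∀ g, ∀ u ∈ V, τ g u ∈ V) ∧
      ∃ e ∈ V, inner ℝ e D ≠ 0 := by
  by_contra! hcon
  set T := averagedRankOne μ τ D with hT
  have hTc : IsCompactOperator T := isCompactOperator_averagedRankOne μ τ hτ D
  have hTs : T.IsSymmetric := by
    intro u v
    change inner ℝ (T u) v = inner ℝ u (T v)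
    rw [real_inner_comm, inner_averagedRankOne μ τ hτ, inner_averagedRankOne μ τ hτ]
    simp [mul_comm]
  -- T D is orthogonal to every eigenspace. For the kernel this is symmetry of T; for a nonzero
  -- eigenvalue the eigenspace is finite-dimensional and invariant, so it is orthogonal to D by
  -- assumption. The spectral theorem then forces T D = 0.
  have hTD : T D = 0 := by
    have hmem : T D ∈ (⨆ a, Module.End.eigenspace (T : Module.End ℝ H) a)ᗮ := by
      rw [Submodule.mem_orthogonal]
      intro e he
      have hle : (⨆ a, Module.End.eigenspace (T : Module.End ℝ H) a) ≤
          LinearMap.ker (innerₛₗ ℝ (T D)) := by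
        refine iSup_le fun a e he => ?_
        have hea : T e = a • e := Module.End.mem_eigenspace_iff.1 he
        have key : inner ℝ (T D) e = a * inner ℝ e D := by
          have := hTs D e
          change inner ℝ (T D) e = inner ℝ D (T e) at this
          rw [this, hea, inner_smul_right, real_inner_comm]
        rw [LinearMap.mem_ker, innerₛₗ_apply_apply, key]
        by_cases ha : a = 0
        · simp [ha]
        · rw [hcon (Module.End.eigenspace (T : Module.End ℝ H) a)
            (ContinuousLinearMap.finite_dimensional_eigenspace hTc a ha) ?_ e he, mul_zero]
          intro g u hu
          rw [Module.End.mem_eigenspace_iff] at hu ⊢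
          change T u = a • u at hu
          change T (τ g u) = a • τ g u
          rw [hT, averagedRankOne_equivariant μ τ hτ, ← hT, hu, map_smul]
      have := hle he
      rwa [LinearMap.mem_ker, innerₛₗ_apply_apply, real_inner_comm] at this
    rw [ContinuousLinearMap.orthogonalComplement_iSup_eigenspaces_eq_bot hTc hTs] at hmem
    simpa using hmem
  -- ⟨D, T D⟩ is the integral of the continuous function ⟨gD, D⟩² ≥ 0, which is ‖D‖⁴ > 0 at g = 1.
  have h0 : ∫ g, inner ℝ (τ g D) D * inner ℝ (τ g D) D ∂μ = 0 := by
    rw [← inner_averagedRankOne μ τ hτ, ← hT, hTD, inner_zero_right]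
  have hc : Continuous fun g => inner ℝ (τ g D) D * inner ℝ (τ g D) D :=
    ((hτ D).inner continuous_const).mul ((hτ D).inner continuous_const)
  have hpos := hc.integral_pos_of_hasCompactSupport_nonneg_nonzero (μ := μ) (x := 1)
    (HasCompactSupport.of_compactSpace _) (fun g => mul_self_nonneg _) (by simpa using hD)
  exact hpos.ne' h0

end PeterWeyl

/-! ### Differentiation under an integral over a compact space -/

section ParametricIntegral

open MeasureTheory

/-- A tube lemma: joint continuity gives a good neighbourhood of each (g₀, x₀), and finitely many of
them cover the compact factor. -/
theorem exists_uniform_nhdsWithin {G : Type*} [TopologicalSpace G] [CompactSpace G]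
    {E F : Type*} [TopologicalSpace E] [PseudoMetricSpace F] {s : Set E} {x₀ : E} (hx₀ : x₀ ∈ s)
    {f : G → E → F} (hf : ContinuousOn (Function.uncurry f) (univ ×ˢ s)) {ε : ℝ} (hε : 0 < ε) :
    ∀ᶠ x in 𝓝[s] x₀, ∀ g, dist (f g x) (f g x₀) ≤ ε := by
  rw [eventually_nhdsWithin_iff]
  have key := isCompact_univ.eventually_forall_of_forall_eventually (x₀ := x₀)
    (K := (univ : Set G)) (P := fun x g => x ∈ s → dist (f g x) (f g x₀) ≤ ε) ?_
  · filter_upwards [key] with x hx hxs g using hx g (mem_univ g) hxs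
  intro g₀ _
  have h1 : ContinuousWithinAt (Function.uncurry f) (univ ×ˢ s) (g₀, x₀) :=
    hf _ ⟨mem_univ _, hx₀⟩
  have h2 : ∀ᶠ p : G × E in 𝓝[univ ×ˢ s] (g₀, x₀), dist (f p.1 p.2) (f g₀ x₀) < ε / 2 :=
    h1.eventually (Metric.ball_mem_nhds _ (half_pos hε))
  rw [eventually_nhdsWithin_iff] at h2
  have h3 : Filter.Tendsto (fun z : E × G => (z.2, z.1)) (𝓝 (x₀, g₀)) (𝓝 (g₀, x₀)) :=
    (continuous_swap.tendsto (x₀, g₀))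
  have h4 : Filter.Tendsto (fun z : E × G => (z.2, x₀)) (𝓝 (x₀, g₀)) (𝓝 (g₀, x₀)) :=
    (continuous_snd.prodMk continuous_const).tendsto (x₀, g₀)
  filter_upwards [h3.eventually h2, h4.eventually h2] with z hz1 hz2 hzs
  have a := hz1 ⟨mem_univ _, hzs⟩
  have b := hz2 ⟨mem_univ _, hx₀⟩
  have := dist_triangle_right (f z.2 z.1) (f z.2 x₀) (f g₀ x₀)
  linarith

variable {G : Type*} [TopologicalSpace G] [CompactSpace G]
  [SecondCountableTopology G] [MeasurableSpace G] [BorelSpace G]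
  {E : Type*} [NormedAddCommGroup E] [NormedSpace ℝ E]
  {F : Type*} [NormedAddCommGroup F] [NormedSpace ℝ F]
  {μ : Measure G} [IsFiniteMeasure μ]

theorem integrable_smul_of_continuous {c : G → ℝ} (hc : Integrable c μ) {f : G → F}
    (hf : Continuous f) : Integrable (fun g => c g • f g) μ := by
  obtain ⟨C, hC⟩ := isCompact_range hf |>.isBounded.exists_norm_le
  exact hc.smul_bdd C hf.aestronglyMeasurable
    (Filter.Eventually.of_forall fun g => hC _ (mem_range_self g))

/-- Convex sets are a basis of the neighbourhoods within `s` of each point of `s`. -/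
def LocallyConvexSet (s : Set E) : Prop :=
  ∀ x ∈ s, ∀ u ∈ 𝓝[s] x, ∃ t ∈ 𝓝[s] x, t ⊆ u ∧ t ⊆ s ∧ Convex ℝ t

/-- The weight is only integrable, since it will be an L² function. The error is controlled by the
mean value inequality for f g − f' g x₀ on a convex neighbourhood within s, where f' is close to its
value at x₀ uniformly in g. The set s need not be open, so that boundary charts are covered. -/
theorem hasFDerivWithinAt_integral_smul [CompleteSpace F] {c : G → ℝ} (hc : Integrable c μ)
    {s : Set E} (hs : LocallyConvexSet s) {f : G → E → F} {f' : G → E → E →L[ℝ] F}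
    (hf : ∀ x ∈ s, Continuous fun g => f g x)
    (hf' : ContinuousOn (Function.uncurry f') (univ ×ˢ s))
    (hff' : ∀ g, ∀ x ∈ s, HasFDerivWithinAt (f g) (f' g x) s x) {x₀ : E} (hx₀ : x₀ ∈ s) :
    HasFDerivWithinAt (fun x => ∫ g, c g • f g x ∂μ) (∫ g, c g • f' g x₀ ∂μ) s x₀ := by
  have hf'c : ∀ x ∈ s, Continuous fun g => f' g x := fun x hx =>
    hf'.comp_continuous (continuous_id.prodMk continuous_const) fun g => ⟨mem_univ _, hx⟩
  rw [hasFDerivWithinAt_iff_isLittleO, Asymptotics.isLittleO_iff]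
  intro ε hε
  set M := ∫ g, ‖c g‖ ∂μ with hM
  have hM0 : 0 ≤ M := integral_nonneg fun _ => norm_nonneg _
  -- The total error is at most M δ ‖x − x₀‖; the added 1 covers M = 0.
  set δ := ε / (M + 1) with hδ
  have hδ0 : 0 < δ := by positivity
  obtain ⟨t, ht, htu, hts, htc⟩ := hs x₀ hx₀ _ (exists_uniform_nhdsWithin hx₀ hf' hδ0)
  filter_upwards [ht] with x hx
  have hxs := hts hx
  have hx₀t : x₀ ∈ t := mem_of_mem_nhdsWithin hx₀ ht
  have hi1 := integrable_smul_of_continuous hc (hf x hxs)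
  have hi2 := integrable_smul_of_continuous hc (hf x₀ hx₀)
  have hi3 := integrable_smul_of_continuous hc (hf'c x₀ hx₀)
  have hi4 : Integrable (fun g => (c g • f' g x₀) (x - x₀)) μ := hi3.apply_continuousLinearMap _
  have hsub : ∫ g, c g • f g x ∂μ - ∫ g, c g • f g x₀ ∂μ - (∫ g, c g • f' g x₀ ∂μ) (x - x₀)
      = ∫ g, (c g • f g x - c g • f g x₀ - (c g • f' g x₀) (x - x₀)) ∂μ := by
    have hi12 : Integrable (fun g => c g • f g x - c g • f g x₀) μ := hi1.sub hi2
    rw [ContinuousLinearMap.integral_apply hi3, integral_sub hi12 hi4, integral_sub hi1 hi2]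
  rw [hsub]
  have hbound : ∀ g, ‖c g • f g x - c g • f g x₀ - (c g • f' g x₀) (x - x₀)‖
      ≤ ‖c g‖ * (δ * ‖x - x₀‖) := by
    intro g
    have := htc.norm_image_sub_le_of_norm_hasFDerivWithin_le' (f := f g) (f' := f' g)
      (φ := f' g x₀) (C := δ) (fun y hy => (hff' g y (hts hy)).mono hts)
      (fun y hy => by have := htu hy g; rwa [dist_eq_norm] at this) hx₀t hx
    have h2 : c g • f g x - c g • f g x₀ - (c g • f' g x₀) (x - x₀)
      = c g • (f g x - f g x₀ - f' g x₀ (x - x₀)) := by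
      simp [smul_sub]
    rw [h2, norm_smul]
    gcongr
  refine (norm_integral_le_of_norm_le (hc.norm.mul_const (δ * ‖x - x₀‖))
    (Filter.Eventually.of_forall hbound)).trans ?_
  rw [integral_mul_const, ← hM, ← mul_assoc]
  gcongr
  rw [hδ, mul_div_assoc', div_le_iff₀ (by positivity)]
  nlinarith

variable {EG : Type*} [NormedAddCommGroup EG] [NormedSpace ℝ EG] [ChartedSpace EG G]
  [IsManifold 𝓘(ℝ, EG) ∞ G]

theorem contMDiffOn_uncurry_fderivWithin {s : Set E} (hsu : UniqueDiffOn ℝ s) {f : G → E → F}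
    (hf : ContMDiffOn (𝓘(ℝ, EG).prod 𝓘(ℝ, E)) 𝓘(ℝ, F) ∞ (Function.uncurry f) (univ ×ˢ s)) :
    ContMDiffOn (𝓘(ℝ, EG).prod 𝓘(ℝ, E)) 𝓘(ℝ, E →L[ℝ] F) ∞
      (Function.uncurry fun g x => fderivWithin ℝ (f g) s x) (univ ×ˢ s) := by
  have : IsManifold 𝓘(ℝ, EG) 1 G := IsManifold.of_le (n := ∞) (by simp)
  rintro ⟨g₀, x₀⟩ ⟨-, hx₀⟩
  have h := ContMDiffWithinAt.mfderivWithin (J := 𝓘(ℝ, EG).prod 𝓘(ℝ, E)) (I := 𝓘(ℝ, E))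
    (I' := 𝓘(ℝ, F)) (m := ∞) (n := ∞)
    (f := fun (p : G × E) (x : E) => f p.1 x) (g := Prod.snd) (t := univ ×ˢ s) (u := s)
    (x₀ := (g₀, x₀)) ?_ contMDiffWithinAt_snd ⟨mem_univ _, hx₀⟩ (fun p hp => hp.2) (by simp)
    hsu.uniqueMDiffOn
  · simp only [inTangentCoordinates_model_space, mfderivWithin_eq_fderivWithin] at h
    exact h
  · have h0 := hf (g₀, x₀) ⟨mem_univ _, hx₀⟩
    have h1 : ContMDiff ((𝓘(ℝ, EG).prod 𝓘(ℝ, E)).prod 𝓘(ℝ, E)) (𝓘(ℝ, EG).prod 𝓘(ℝ, E)) ∞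
        (fun p : (G × E) × E => (p.1.1, p.2)) :=
      (contMDiff_fst.comp contMDiff_fst).prodMk contMDiff_snd
    exact ContMDiffWithinAt.comp (t := univ ×ˢ s) (f := fun p : (G × E) × E => (p.1.1, p.2))
      ((g₀, x₀), x₀) h0 (h1 _).contMDiffWithinAt (fun p hp => ⟨mem_univ _, hp.2⟩)

theorem differentiableWithinAt_of_uncurry {s : Set E} {f : G → E → F}
    (hf : ContMDiffOn (𝓘(ℝ, EG).prod 𝓘(ℝ, E)) 𝓘(ℝ, F) ∞ (Function.uncurry f) (univ ×ˢ s)) (g : G)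
    {x : E} (hx : x ∈ s) : DifferentiableWithinAt ℝ (f g) s x := by
  have h0 := hf (g, x) ⟨mem_univ _, hx⟩
  have : ContMDiffWithinAt 𝓘(ℝ, E) 𝓘(ℝ, F) ∞ (f g) s x :=
    ContMDiffWithinAt.comp (I' := 𝓘(ℝ, EG).prod 𝓘(ℝ, E)) (t := univ ×ˢ s)
      (f := fun x => (g, x)) x h0
      ((contMDiff_const.prodMk contMDiff_id : ContMDiff 𝓘(ℝ, E) (𝓘(ℝ, EG).prod 𝓘(ℝ, E)) ∞
        fun x : E => (g, x)) x).contMDiffWithinAt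
      (fun p hp => ⟨mem_univ _, hp⟩)
  exact this.contDiffWithinAt.differentiableWithinAt (by simp)

theorem hasFDerivWithinAt_integral_of_contMDiffOn [CompleteSpace F]
    {c : G → ℝ} (hc : Integrable c μ)
    {s : Set E} (hs : LocallyConvexSet s) (hsu : UniqueDiffOn ℝ s) {f : G → E → F}
    (hf : ContMDiffOn (𝓘(ℝ, EG).prod 𝓘(ℝ, E)) 𝓘(ℝ, F) ∞ (Function.uncurry f) (univ ×ˢ s))
    {x₀ : E} (hx₀ : x₀ ∈ s) :
    HasFDerivWithinAt (fun x => ∫ g, c g • f g x ∂μ)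
      (∫ g, c g • fderivWithin ℝ (f g) s x₀ ∂μ) s x₀ :=
  hasFDerivWithinAt_integral_smul hc hs
    (f' := fun g x => fderivWithin ℝ (f g) s x)
    (fun _ hx => hf.continuousOn.comp_continuous (continuous_id.prodMk continuous_const)
      fun _ => ⟨mem_univ _, hx⟩)
    (contMDiffOn_uncurry_fderivWithin hsu hf).continuousOn
    (fun g _ hx => (differentiableWithinAt_of_uncurry hf g hx).hasFDerivWithinAt) hx₀

/-- Induction on the order: the derivative of the integral, evaluated at a fixed vector, is again an
integral of the same kind. Finite dimension of E permits checking smoothness of the derivative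
vector by vector, which keeps the target F fixed through the induction. -/
theorem contDiffOn_integral_smul [FiniteDimensional ℝ E] [CompleteSpace F]
    {c : G → ℝ} (hc : Integrable c μ)
    {s : Set E} (hs : LocallyConvexSet s) (hsu : UniqueDiffOn ℝ s) (n : ℕ) {f : G → E → F}
    (hf : ContMDiffOn (𝓘(ℝ, EG).prod 𝓘(ℝ, E)) 𝓘(ℝ, F) ∞ (Function.uncurry f) (univ ×ˢ s)) :
    ContDiffOn ℝ n (fun x => ∫ g, c g • f g x ∂μ) s := by
  have hderiv := fun {f : G → E → F} hf {x₀ : E} hx₀ =>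
    hasFDerivWithinAt_integral_of_contMDiffOn (EG := EG) (f := f) hc hs hsu hf (x₀ := x₀) hx₀
  induction n generalizing f with
  | zero =>
    exact contDiffOn_zero.2 fun x hx => (hderiv hf hx).continuousWithinAt
  | succ n ih =>
    rw [Nat.cast_succ, contDiffOn_succ_iff_fderivWithin hsu]
    refine ⟨fun x hx => (hderiv hf hx).differentiableWithinAt, by simp, ?_⟩
    rw [contDiffOn_clm_apply]
    intro y
    have hf2 := contMDiffOn_uncurry_fderivWithin hsu hf
    refine (ih (f := fun g x => fderivWithin ℝ (f g) s x y) ?_).congr ?_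
    · exact hf2.clm_apply contMDiffOn_const
    · intro x hx
      rw [(hderiv hf hx).fderivWithin (hsu x hx), ContinuousLinearMap.integral_apply]
      · simp
      · exact integrable_smul_of_continuous hc
          (hf2.continuousOn.comp_continuous (continuous_id.prodMk continuous_const)
            fun g => ⟨mem_univ _, hx⟩)

end ParametricIntegral

/-- The differential of a vector-valued map on a manifold, on the model space of tangent vectors. -/
noncomputable def differential {ES : Type*} [NormedAddCommGroup ES] [NormedSpace ℝ ES] {HS : Type*}
    [TopologicalSpace HS] (IS : ModelWithCorners ℝ ES HS) {S : Type*} [TopologicalSpace S]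
    [ChartedSpace HS S] {F : Type*} [NormedAddCommGroup F] [NormedSpace ℝ F] (f : S → F) (x : S) :
    ES →L[ℝ] F :=
  mfderiv IS 𝓘(ℝ, F) f x

/-! ### Parametric integrals on manifolds with boundary or corners -/

section ParametricIntegralManifold

open MeasureTheory

/-- Near a point of the chart target, the target agrees with the range of the model, which is
convex, so its intersections with small balls serve. Boundary points need no separate treatment. -/
theorem locallyConvexSet_extChartAt_target {E : Type*} [NormedAddCommGroup E] [NormedSpace ℝ E]
    {H : Type*} [TopologicalSpace H] (I : ModelWithCorners ℝ E H) {M : Type*} [TopologicalSpace M]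
    [ChartedSpace H M] (x : M) : LocallyConvexSet (extChartAt I x).target := by
  intro y hy u hu
  have hmem := Filter.inter_mem hu self_mem_nhdsWithin
  rw [nhdsWithin_extChartAt_target_eq_of_mem hy] at hmem ⊢
  obtain ⟨ε, hε, hsub⟩ := Metric.mem_nhdsWithin_iff.1 hmem
  exact ⟨Metric.ball y ε ∩ range I, Filter.inter_mem (mem_nhdsWithin_of_mem_nhds (Metric.ball_mem_nhds y hε)) self_mem_nhdsWithin,
    fun z hz => (hsub hz).1, fun z hz => (hsub hz).2, (convex_ball y ε).inter I.convex_range⟩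

variable {G : Type*} [TopologicalSpace G] [CompactSpace G]
  [SecondCountableTopology G] [MeasurableSpace G] [BorelSpace G]
  {F : Type*} [NormedAddCommGroup F] [NormedSpace ℝ F] [CompleteSpace F]
  {μ : Measure G} [IsFiniteMeasure μ]
  {EG : Type*} [NormedAddCommGroup EG] [NormedSpace ℝ EG] [ChartedSpace EG G]
  [IsManifold 𝓘(ℝ, EG) ∞ G]
  {ES : Type*} [NormedAddCommGroup ES] [NormedSpace ℝ ES] [FiniteDimensional ℝ ES]
  {HS : Type*} [TopologicalSpace HS] {IS : ModelWithCorners ℝ ES HS}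
  {S : Type*} [TopologicalSpace S] [ChartedSpace HS S] [IsManifold IS ∞ S]
  {c : G → ℝ} {f : G → S → F}

theorem contMDiffOn_uncurry_extChartAt_symm
    (hf : ContMDiff (𝓘(ℝ, EG).prod IS) 𝓘(ℝ, F) ∞ (Function.uncurry f)) (x : S) :
    ContMDiffOn (𝓘(ℝ, EG).prod 𝓘(ℝ, ES)) 𝓘(ℝ, F) ∞
      (Function.uncurry fun g y => f g ((extChartAt IS x).symm y))
      (univ ×ˢ (extChartAt IS x).target) := by
  have h1 : ContMDiffOn (𝓘(ℝ, EG).prod 𝓘(ℝ, ES)) (𝓘(ℝ, EG).prod IS) ∞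
      (fun p : G × ES => (p.1, (extChartAt IS x).symm p.2)) (univ ×ˢ (extChartAt IS x).target) :=
    contMDiffOn_fst.prodMk ((contMDiffOn_extChartAt_symm x).comp contMDiffOn_snd fun p hp => hp.2)
  exact hf.comp_contMDiffOn h1

theorem contMDiff_integral_smul (hc : Integrable c μ)
    (hf : ContMDiff (𝓘(ℝ, EG).prod IS) 𝓘(ℝ, F) ∞ (Function.uncurry f)) :
    ContMDiff IS 𝓘(ℝ, F) ∞ (fun x => ∫ g, c g • f g x ∂μ) := by
  intro x
  have h : ContDiffOn ℝ ∞ (fun y => ∫ g, c g • f g ((extChartAt IS x).symm y) ∂μ)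
      (extChartAt IS x).target :=
    contDiffOn_infty.2 fun n => contDiffOn_integral_smul (EG := EG) hc
      (locallyConvexSet_extChartAt_target IS x) (uniqueDiffOn_extChartAt_target x) n
      (contMDiffOn_uncurry_extChartAt_symm hf x)
  have h2 : ContMDiffOn IS 𝓘(ℝ, F) ∞ ((fun y => ∫ g, c g • f g ((extChartAt IS x).symm y) ∂μ) ∘
      extChartAt IS x) (chartAt HS x).source :=
    h.contMDiffOn.comp contMDiffOn_extChartAt
      fun y hy => (extChartAt IS x).map_source (by rwa [extChartAt_source])
  have hmem : (chartAt HS x).source ∈ 𝓝 x := chart_source_mem_nhds HS x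
  refine (h2.contMDiffAt hmem).congr_of_eventuallyEq ?_
  filter_upwards [hmem] with y hy
  have hy' : y ∈ (extChartAt IS x).source := by rwa [extChartAt_source]
  simp only [Function.comp_apply, (extChartAt IS x).left_inv hy']

theorem mdifferentiableAt_of_uncurry
    (hf : ContMDiff (𝓘(ℝ, EG).prod IS) 𝓘(ℝ, F) ∞ (Function.uncurry f)) (g : G) (x : S) :
    MDifferentiableAt IS 𝓘(ℝ, F) (f g) x :=
  ((hf.comp (contMDiff_const.prodMk contMDiff_id : ContMDiff IS (𝓘(ℝ, EG).prod IS) ∞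
    fun x : S => (g, x))).mdifferentiable (by simp)) x

theorem differential_eq_fderivWithin {h : S → F} {x : S}
    (hh : MDifferentiableAt IS 𝓘(ℝ, F) h x) :
    differential IS h x = fderivWithin ℝ (fun y => h ((extChartAt IS x).symm y))
      (extChartAt IS x).target (extChartAt IS x x) := by
  have h' : HasFDerivWithinAt (fun y => h ((extChartAt IS x).symm y)) (differential IS h x)
      (range IS) (extChartAt IS x x) := hh.hasMFDerivAt.2
  exact ((h'.mono (extChartAt_target_subset_range x)).fderivWithin
    (uniqueDiffOn_extChartAt_target x _ (mem_extChartAt_target x))).symm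

theorem continuous_differential_of_uncurry
    (hf : ContMDiff (𝓘(ℝ, EG).prod IS) 𝓘(ℝ, F) ∞ (Function.uncurry f)) (x : S) :
    Continuous fun g => differential IS (f g) x := by
  have h := contMDiffOn_uncurry_fderivWithin (uniqueDiffOn_extChartAt_target x)
    (contMDiffOn_uncurry_extChartAt_symm hf x)
  have h2 := h.continuousOn.comp_continuous (f := fun g : G => (g, extChartAt IS x x))
    (continuous_id.prodMk continuous_const) fun g => ⟨mem_univ _, mem_extChartAt_target x⟩
  refine h2.congr fun g => ?_
  rw [differential_eq_fderivWithin (mdifferentiableAt_of_uncurry hf g x)]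
  rfl

theorem differential_integral_smul (hc : Integrable c μ)
    (hf : ContMDiff (𝓘(ℝ, EG).prod IS) 𝓘(ℝ, F) ∞ (Function.uncurry f)) (x : S) (v : ES) :
    differential IS (fun x => ∫ g, c g • f g x ∂μ) x v
      = ∫ g, c g • differential IS (f g) x v ∂μ := by
  have h := hasFDerivWithinAt_integral_of_contMDiffOn (EG := EG) hc
    (locallyConvexSet_extChartAt_target IS x) (uniqueDiffOn_extChartAt_target x)
    (contMDiffOn_uncurry_extChartAt_symm hf x) (mem_extChartAt_target x)
  rw [differential_eq_fderivWithin
    ((contMDiff_integral_smul hc hf).mdifferentiable (by simp) x),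
    h.fderivWithin (uniqueDiffOn_extChartAt_target x _ (mem_extChartAt_target x))]
  have hcont := continuous_differential_of_uncurry hf x
  simp only [differential_eq_fderivWithin (mdifferentiableAt_of_uncurry hf _ x)]
    at hcont ⊢
  exact ContinuousLinearMap.integral_apply (integrable_smul_of_continuous hc hcont) v

end ParametricIntegralManifold

/-! ### Local structure of immersions -/

section Immersion

variable {ES : Type*} [NormedAddCommGroup ES] [NormedSpace ℝ ES]
  {HS : Type*} [TopologicalSpace HS] {IS : ModelWithCorners ℝ ES HS}
  {S : Type*} [TopologicalSpace S] [ChartedSpace HS S] [IsManifold IS ∞ S]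
  {F : Type*} [NormedAddCommGroup F] [NormedSpace ℝ F]

/-- The differential of `f` at `x`, read in the chart around `x₀`. -/
noncomputable def chartDifferential (IS : ModelWithCorners ℝ ES HS) (f : S → F) (x₀ x : S) :
    ES →L[ℝ] F :=
  fderivWithin ℝ (fun y => f ((extChartAt IS x₀).symm y)) (extChartAt IS x₀).target
    (extChartAt IS x₀ x)

theorem contDiffOn_comp_extChartAt_symm {f : S → F} (hf : ContMDiff IS 𝓘(ℝ, F) ∞ f) (x₀ : S) :
    ContDiffOn ℝ ∞ (fun y => f ((extChartAt IS x₀).symm y)) (extChartAt IS x₀).target :=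
  (hf.comp_contMDiffOn (contMDiffOn_extChartAt_symm x₀)).contDiffOn

theorem contMDiffOn_chartDifferential {f : S → F} (hf : ContMDiff IS 𝓘(ℝ, F) ∞ f) (x₀ : S) :
    ContMDiffOn IS 𝓘(ℝ, ES →L[ℝ] F) ∞ (chartDifferential IS f x₀) (chartAt HS x₀).source :=
  ((contDiffOn_comp_extChartAt_symm hf x₀).fderivWithin (m := ∞)
    (uniqueDiffOn_extChartAt_target x₀) (by simp)).contMDiffOn.comp contMDiffOn_extChartAt
    fun y hy => (extChartAt IS x₀).map_source (by rwa [extChartAt_source])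

/-- The frame of the tangent bundle defined by the chart around `x₀`. -/
noncomputable def chartFrame (IS : ModelWithCorners ℝ ES HS) [IsManifold IS ∞ S] (x₀ x : S) :
    ES →L[ℝ] ES :=
  have : IsManifold IS 1 S := IsManifold.of_le (n := ∞) (by simp)
  (trivializationAt ES (TangentSpace IS) x₀).symmL ℝ x

/-- The frame is the derivative of the inverse chart, so this is the chain rule. It is needed
because `differential` at x is expressed in the preferred chart of x itself and need not vary
continuously with x, whereas `chartDifferential` is smooth on the domain of a fixed chart. -/
theorem differential_chartFrame {f : S → F} (hf : ContMDiff IS 𝓘(ℝ, F) ∞ f) {x₀ x : S}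
    (hx : x ∈ (chartAt HS x₀).source) (u : ES) :
    differential IS f x (chartFrame IS x₀ x u) = chartDifferential IS f x₀ x u := by
  have : IsManifold IS 1 S := IsManifold.of_le (n := ∞) (by simp)
  have hx' : x ∈ (extChartAt IS x₀).source := by rwa [extChartAt_source]
  have ht := (extChartAt IS x₀).map_source hx'
  have h1 : chartFrame IS x₀ x = mfderivWithin 𝓘(ℝ, ES) IS (extChartAt IS x₀).symm (range IS)
      (extChartAt IS x₀ x) := TangentBundle.symmL_trivializationAt hx
  have hs : MDifferentiableWithinAt 𝓘(ℝ, ES) IS (extChartAt IS x₀).symm (range IS)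
      (extChartAt IS x₀ x) := mdifferentiableWithinAt_extChartAt_symm ht
  have hxx : (extChartAt IS x₀).symm (extChartAt IS x₀ x) = x := (extChartAt IS x₀).left_inv hx'
  have hfd : MDifferentiableAt IS 𝓘(ℝ, F) f ((extChartAt IS x₀).symm (extChartAt IS x₀ x)) :=
    hf.mdifferentiable (by simp) _
  have hc : HasFDerivWithinAt (fun y => f ((extChartAt IS x₀).symm y))
      ((differential IS f ((extChartAt IS x₀).symm (extChartAt IS x₀ x))).comp
        (chartFrame IS x₀ x)) (range IS) (extChartAt IS x₀ x) := by
    rw [h1]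
    exact (hfd.hasMFDerivAt.comp_hasMFDerivWithinAt _ hs.hasMFDerivWithinAt).hasFDerivWithinAt
  have hc' := (hc.mono (extChartAt_target_subset_range x₀)).fderivWithin
    (uniqueDiffOn_extChartAt_target x₀ _ ht)
  have key : chartDifferential IS f x₀ x u =
      differential IS f ((extChartAt IS x₀).symm (extChartAt IS x₀ x)) (chartFrame IS x₀ x u) :=
    congrArg (fun L : ES →L[ℝ] F => L u) hc'
  rw [key, hxx]

theorem chartFrame_surjective {x₀ x : S} (hx : x ∈ (chartAt HS x₀).source) (v : ES) :
    ∃ u, chartFrame IS x₀ x u = v := by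
  have : IsManifold IS 1 S := IsManifold.of_le (n := ∞) (by simp)
  have hx' : x ∈ (trivializationAt ES (TangentSpace IS) x₀).baseSet := by
    rwa [TangentBundle.trivializationAt_baseSet]
  exact ⟨(trivializationAt ES (TangentSpace IS) x₀).continuousLinearMapAt ℝ x v,
    (trivializationAt ES (TangentSpace IS) x₀).symmL_continuousLinearMapAt hx' v⟩

theorem contMDiffOn_oneForm_chartFrame (w : SmoothOneForm IS S) (x₀ : S) (u : ES) :
    ContMDiffOn IS 𝓘(ℝ, ℝ) ∞ (fun x => w x (chartFrame IS x₀ x u)) (chartAt HS x₀).source := by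
  have : IsManifold IS 1 S := IsManifold.of_le (n := ∞) (by simp)
  have h1 := (trivializationAt ES (TangentSpace IS : S → Type _) x₀).contMDiffOn_symmL
    (n := ∞) (IB := IS)
  rw [TangentBundle.trivializationAt_baseSet] at h1
  have h2 : ContMDiffOn IS (IS.prod 𝓘(ℝ, ES)) ∞
      (fun m => Bundle.TotalSpace.mk' ES (E := Bundle.Trivial S ES) m u)
      (chartAt HS x₀).source := by
    intro x _
    exact Bundle.contMDiffWithinAt_section.2 contMDiffWithinAt_const
  have h3 := h1.clm_bundle_apply h2
  have h4 := (w.contMDiff.contMDiffOn (s := (chartAt HS x₀).source)).clm_bundle_apply h3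
  intro x hx
  exact Bundle.contMDiffWithinAt_section.1 (h4 x hx)

variable [FiniteDimensional ℝ ES]

/-- Near a point where a vector-valued map is an immersion, it is an injective immersion, and every
smooth 1-form is the composition of its differential with smooth coefficients. -/
theorem exists_nhds_immersion [FiniteDimensional ℝ F] {f : S → F} (hf : ContMDiff IS 𝓘(ℝ, F) ∞ f)
    {x₀ : S} (hinj : Function.Injective (differential IS f x₀)) :
    ∃ U ∈ 𝓝 x₀, InjOn f U ∧ (∀ x ∈ U, Function.Injective (differential IS f x)) ∧
      ∀ w : SmoothOneForm IS S, ∃ b : S → F →L[ℝ] ℝ, ContMDiffOn IS 𝓘(ℝ, F →L[ℝ] ℝ) ∞ b U ∧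
        ∀ x ∈ U, ∀ v : ES, b x (differential IS f x v) = w x v := by
  set A := chartDifferential IS f x₀ with hA
  have hx₀ := mem_chart_source HS x₀
  have hA0 : A x₀ = differential IS f x₀ := by
    rw [differential_eq_fderivWithin (hf.mdifferentiable (by simp) x₀)]; rfl
  -- A left inverse L at x₀ controls all nearby points: L ∘ A x is close to the identity, hence
  -- invertible.
  obtain ⟨L₀, hL₀⟩ := LinearMap.exists_leftInverse_of_injective (A x₀ : ES →ₗ[ℝ] F)
    (LinearMap.ker_eq_bot.2 (by rw [hA0]; exact hinj))
  set L : F →L[ℝ] ES := LinearMap.toContinuousLinearMap L₀ with hL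
  have hLA : L.comp (A x₀) = ContinuousLinearMap.id ℝ ES := by
    ext u; exact congrArg (fun T : ES →ₗ[ℝ] ES => T u) hL₀
  have hAs := contMDiffOn_chartDifferential hf x₀
  have hLAs : ContMDiffOn IS 𝓘(ℝ, ES →L[ℝ] ES) ∞ (fun x => L.comp (A x)) (chartAt HS x₀).source :=
    contMDiffOn_const.clm_comp hAs
  have hsrc : (chartAt HS x₀).source ∈ 𝓝 x₀ := chart_source_mem_nhds HS x₀
  set V : Set S := (chartAt HS x₀).source ∩ (fun x => L.comp (A x)) ⁻¹'
    range ((↑) : (ES ≃L[ℝ] ES) → ES →L[ℝ] ES) with hV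
  have hVn : V ∈ 𝓝 x₀ := by
    have hcont : ContinuousAt (fun x => L.comp (A x)) x₀ := hLAs.continuousOn.continuousAt hsrc
    refine Filter.inter_mem hsrc (hcont.preimage_mem_nhds ?_)
    rw [hLA]
    exact ContinuousLinearEquiv.nhds (ContinuousLinearEquiv.refl ℝ ES)
  -- local injectivity, from the mean value inequality in the chart
  obtain ⟨W, hW, hWinj⟩ : ∃ W ∈ 𝓝 x₀, InjOn f W := by
    set fc : ES → F := fun y => f ((extChartAt IS x₀).symm y) with hfc
    set t := (extChartAt IS x₀).target with ht
    have hfcs := contDiffOn_comp_extChartAt_symm hf x₀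
    have hy₀ : extChartAt IS x₀ x₀ ∈ t := mem_extChartAt_target x₀
    have hd : ContinuousOn (fun y => L.comp (fderivWithin ℝ fc t y)) t :=
      continuousOn_const.clm_comp
        (hfcs.continuousOn_fderivWithin (uniqueDiffOn_extChartAt_target x₀) (by simp))
    have hev : ∀ᶠ y in 𝓝[t] (extChartAt IS x₀ x₀),
        ‖L.comp (fderivWithin ℝ fc t y) - ContinuousLinearMap.id ℝ ES‖ < 1 / 2 := by
      have := (hd _ hy₀).eventually (Metric.ball_mem_nhds _ (by norm_num : (0 : ℝ) < 1 / 2))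
      filter_upwards [this] with y hy
      have h0 : L.comp (fderivWithin ℝ fc t (extChartAt IS x₀ x₀)) = ContinuousLinearMap.id ℝ ES :=
        hLA
      rw [← h0, ← dist_eq_norm]
      exact hy
    obtain ⟨s, hs, hsub, hst, hsc⟩ := locallyConvexSet_extChartAt_target IS x₀ _ hy₀ _ hev
    have hinj_s : InjOn fc s := by
      intro y hy y' hy' hyy
      have := hsc.norm_image_sub_le_of_norm_hasFDerivWithin_le' (f := fun y => L (fc y))
        (f' := fun y => L.comp (fderivWithin ℝ fc t y)) (φ := ContinuousLinearMap.id ℝ ES)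
        (C := 1 / 2)
        (fun z hz => (L.hasFDerivAt.comp_hasFDerivWithinAt z
          ((hfcs.differentiableOn (by simp) z (hst hz)).hasFDerivWithinAt)).mono hst)
        (fun z hz => (hsub hz).le) hy hy'
      simp only [hyy, sub_self, zero_sub, norm_neg, ContinuousLinearMap.coe_id', id] at this
      have h0 : ‖y' - y‖ = 0 := by linarith [norm_nonneg (y' - y)]
      exact (sub_eq_zero.1 (norm_eq_zero.1 h0)).symm
    refine ⟨(chartAt HS x₀).source ∩ extChartAt IS x₀ ⁻¹' s, Filter.inter_mem hsrc ?_, ?_⟩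
    · rw [nhdsWithin_extChartAt_target_eq] at hs
      have := extChartAt_preimage_mem_nhds_of_mem_nhdsWithin (I := IS)
        (mem_extChartAt_source (I := IS) x₀) hs
      exact this
    · rintro x ⟨hx, hxs⟩ x' ⟨hx', hxs'⟩ hxx
      rw [← extChartAt_source IS] at hx hx'
      apply (extChartAt IS x₀).injOn hx hx'
      apply hinj_s hxs hxs'
      simp only [hfc, (extChartAt IS x₀).left_inv hx, (extChartAt IS x₀).left_inv hx', hxx]
  refine ⟨V ∩ W, Filter.inter_mem hVn hW, hWinj.mono inter_subset_right, ?_, fun w => ?_⟩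
  · rintro x ⟨⟨hx, e, he : (e : ES →L[ℝ] ES) = L.comp (A x)⟩, -⟩
    rw [injective_iff_map_eq_zero]
    intro v hv
    obtain ⟨u, rfl⟩ := chartFrame_surjective (IS := IS) hx v
    rw [differential_chartFrame hf hx] at hv
    have : e u = 0 := by
      change (e : ES →L[ℝ] ES) u = 0
      rw [he]
      simp [hA, hv]
    rw [(map_eq_zero_iff _ e.injective).1 this, map_zero]
  · let bas := Module.finBasis ℝ ES
    let η : S → ES →L[ℝ] ℝ := fun x => ∑ i, w x (chartFrame IS x₀ x (bas i)) •
      (LinearMap.toContinuousLinearMap (bas.coord i))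
    have hη : ContMDiffOn IS 𝓘(ℝ, ES →L[ℝ] ℝ) ∞ η (chartAt HS x₀).source := by
      apply contMDiffOn_finsetSum
      intro i _
      exact (contMDiffOn_oneForm_chartFrame w x₀ (bas i)).smul contMDiffOn_const
    have hηu : ∀ x u, η x u = w x (chartFrame IS x₀ x u) := by
      intro x u
      have hT : ∀ T : ES →L[ℝ] ℝ, (∑ i, T (bas i) •
          (LinearMap.toContinuousLinearMap (bas.coord i) : ES →L[ℝ] ℝ)) u = T u := by
        intro T
        conv_rhs => rw [← bas.sum_repr u, map_sum]
        simp only [sum_apply, smul_apply,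
          LinearMap.coe_toContinuousLinearMap', Module.Basis.coord_apply, map_smul, smul_eq_mul,
          mul_comm]
      exact hT ((show ES →L[ℝ] ℝ from w x).comp (chartFrame IS x₀ x))
    -- η is w in the frame of the chart, and (L ∘ A x)⁻¹ ∘ L is a left inverse of A x depending
    -- smoothly on x.
    refine ⟨fun x => (η x).comp ((L.comp (A x)).inverse.comp L), ?_, ?_⟩
    · refine (hη.mono fun x hx => hx.1.1).clm_comp (ContMDiffOn.clm_comp ?_ contMDiffOn_const)
      rintro x ⟨⟨hx, e, he : (e : ES →L[ℝ] ES) = L.comp (A x)⟩, -⟩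
      have h1 : ContDiffAt ℝ ∞ ContinuousLinearMap.inverse (L.comp (A x)) := by
        rw [← he]; exact contDiffAt_map_inverse e
      exact h1.contMDiffAt.comp_contMDiffWithinAt x
        ((hLAs x hx).mono (inter_subset_left.trans inter_subset_left))
    · rintro x ⟨⟨hx, e, he : (e : ES →L[ℝ] ES) = L.comp (A x)⟩, -⟩ v
      obtain ⟨u, rfl⟩ := chartFrame_surjective (IS := IS) hx v
      rw [differential_chartFrame hf hx]
      have h1 : (L.comp (A x)).inverse (L (A x u)) = u := by
        have : L (A x u) = e u := by
          change (L.comp (A x)) u = (e : ES →L[ℝ] ES) u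
          rw [he]
        rw [this, ← he, ContinuousLinearMap.inverse_equiv]
        simp
      change η x ((L.comp (A x)).inverse (L (A x u))) = _
      rw [h1, hηu]

end Immersion

/-! ### Homotheties, the radial field and homogeneous forms -/

namespace SmoothCone

variable
    {ES : Type*} [NormedAddCommGroup ES] [NormedSpace ℝ ES] {HS : Type*} [TopologicalSpace HS]
    {IS : ModelWithCorners ℝ ES HS}
    {EX : Type*} [NormedAddCommGroup EX] [NormedSpace ℝ EX] {HX : Type*} [TopologicalSpace HX]
    {IX : ModelWithCorners ℝ EX HX}
    {S : Type*} [TopologicalSpace S] [ChartedSpace HS S]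
    {X : Type*} [TopologicalSpace X] [ChartedSpace HX X]
    {F : Type*} [NormedAddCommGroup F] [NormedSpace ℝ F]
    (C : SmoothCone IS IX S X)

theorem contMDiffAt_dil {t : ℝ} (ht : 0 < t) (x : S) :
    ContMDiffAt (𝓘(ℝ, ℝ).prod IS) IS ∞ (fun q : ℝ × S => C.dil q.1 q.2) (t, x) :=
  C.contMDiffOn_dil.contMDiffAt ((isOpen_Ioi.prod isOpen_univ).mem_nhds ⟨ht, mem_univ x⟩)

theorem contMDiff_dil_comp {h : S → ℝ} (hh : ContMDiff IS 𝓘(ℝ, ℝ) ∞ h) (hpos : ∀ x, 0 < h x) :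
    ContMDiff IS IS ∞ (fun x => C.dil (h x) x) := fun x =>
  ContMDiffAt.comp (f := fun x => (h x, x)) (g := fun q : ℝ × S => C.dil q.1 q.2) x
    (C.contMDiffAt_dil (hpos x) x) ((hh.prodMk contMDiff_id) x)

theorem contMDiff_dil {t : ℝ} (ht : 0 < t) : ContMDiff IS IS ∞ (C.dil t) :=
  C.contMDiff_dil_comp contMDiff_const fun _ => ht

theorem contMDiffAt_dil_left {t : ℝ} (ht : 0 < t) (x : S) :
    ContMDiffAt 𝓘(ℝ, ℝ) IS ∞ (fun s => C.dil s x) t :=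
  ContMDiffAt.comp (f := fun s : ℝ => (s, x)) (g := fun q : ℝ × S => C.dil q.1 q.2) t
    (C.contMDiffAt_dil ht x) ((contMDiff_id.prodMk contMDiff_const) t)

theorem dil_inv_dil {t : ℝ} (ht : 0 < t) (x : S) : C.dil t⁻¹ (C.dil t x) = x := by
  rw [← C.dil_mul _ _ (inv_pos.2 ht) ht, inv_mul_cancel₀ ht.ne', C.dil_one]

/-- The radial field is a velocity at `dil 1 x` transported to x; this removes the transport. -/
theorem mfderiv_cast_tangent {M : Type*} [TopologicalSpace M] {H' : Type*} [TopologicalSpace H']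
    {E' : Type*} [NormedAddCommGroup E'] [NormedSpace ℝ E'] {I' : ModelWithCorners ℝ E' H'}
    [ChartedSpace H' M] (f : S → M) {x y : S} (h : y = x) (u : TangentSpace IS y) :
    (mfderiv IS I' f x (cast (congrArg (fun y : S => TangentSpace IS y) h) u) : E')
      = (mfderiv IS I' f y u : E') := by
  subst h; rfl

theorem mfderiv_radialField {M : Type*} [TopologicalSpace M] {H' : Type*} [TopologicalSpace H']
    {E' : Type*} [NormedAddCommGroup E'] [NormedSpace ℝ E'] {I' : ModelWithCorners ℝ E' H'}
    [ChartedSpace H' M] {f : S → M} {x : S} (hf : MDifferentiableAt IS I' f x) :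
    (mfderiv IS I' f x (C.radialField x) : E')
      = (mfderiv 𝓘(ℝ, ℝ) I' (fun t : ℝ => f (C.dil t x)) 1 (1 : ℝ) : E') := by
  have hd : MDifferentiableAt 𝓘(ℝ, ℝ) IS (fun t => C.dil t x) 1 :=
    (C.contMDiffAt_dil_left one_pos x).mdifferentiableAt (by simp)
  have hf' : MDifferentiableAt IS I' f (C.dil 1 x) := by rwa [C.dil_one]
  rw [radialField, mfderiv_cast_tangent f (C.dil_one x)]
  have := mfderiv_comp (I := 𝓘(ℝ, ℝ)) (I' := IS) (I'' := I') (f := fun t => C.dil t x) (g := f)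
    (1 : ℝ) hf' hd
  change _ = (mfderiv 𝓘(ℝ, ℝ) I' (f ∘ fun t : ℝ => C.dil t x) 1 (1 : ℝ) : E')
  rw [this]
  rfl

theorem differential_radialField {f : S → F} {x : S} (hf : MDifferentiableAt IS 𝓘(ℝ, F) f x) :
    differential IS f x (C.radialField x) = deriv (fun t => f (C.dil t x)) 1 := by
  have := C.mfderiv_radialField hf
  rw [mfderiv_eq_fderiv] at this
  exact this

theorem differential_radialField_of_degree_zero {f : S → F} {x : S}
    (hf : MDifferentiableAt IS 𝓘(ℝ, F) f x) (h0 : ∀ t, 0 < t → f (C.dil t x) = f x) :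
    differential IS f x (C.radialField x) = 0 := by
  rw [C.differential_radialField hf]
  have : (fun t => f (C.dil t x)) =ᶠ[𝓝 1] fun _ => f x := by
    filter_upwards [isOpen_Ioi.mem_nhds (mem_Ioi.2 (one_pos (α := ℝ)))] with t ht
    exact h0 t ht
  rw [this.deriv_eq, deriv_const]

theorem differential_radialField_of_degree_one {f : S → ℝ} {x : S}
    (hf : MDifferentiableAt IS 𝓘(ℝ, ℝ) f x) (h1 : ∀ t, 0 < t → f (C.dil t x) = t * f x) :
    differential IS f x (C.radialField x) = f x := by
  rw [C.differential_radialField hf]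
  have : (fun t => f (C.dil t x)) =ᶠ[𝓝 1] fun t => t * f x := by
    filter_upwards [isOpen_Ioi.mem_nhds (mem_Ioi.2 (one_pos (α := ℝ)))] with t ht
    exact h1 t ht
  rw [this.deriv_eq, deriv_mul_const_field, deriv_id'', one_mul]

theorem mfderiv_proj_radialField (x : S) :
    mfderiv IS IX C.proj x (C.radialField x) = 0 := by
  have h := C.mfderiv_radialField (C.contMDiff_proj.mdifferentiable (by simp) x)
  have : (fun t => C.proj (C.dil t x)) =ᶠ[𝓝 1] fun _ => C.proj x := by
    filter_upwards [isOpen_Ioi.mem_nhds (mem_Ioi.2 (one_pos (α := ℝ)))] with t ht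
    exact C.proj_dil t ht x
  rw [this.mfderiv_eq, mfderiv_const] at h
  exact h

/-- In a trivialization the fibre is a half-line on which homotheties multiply, so the required
ratio is the quotient of the fibre coordinates. -/
theorem exists_dil_eq_of_proj_eq {x y : S} (h : C.proj x = C.proj y) :
    ∃ t, 0 < t ∧ C.dil t x = y := by
  obtain ⟨U, φ, -, hbU, hsrc, htgt, -, -, hφ⟩ := C.exists_trivialization (C.proj x)
  have hx : x ∈ φ.source := by rw [hsrc]; exact hbU
  have hy : y ∈ φ.source := by rw [hsrc, mem_preimage, ← h]; exact hbU
  have hx2 : 0 < (φ x).2 := by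
    have := φ.map_source hx; rw [htgt] at this; exact this.2
  have hy2 : 0 < (φ y).2 := by
    have := φ.map_source hy; rw [htgt] at this; exact this.2
  have ht : 0 < (φ y).2 / (φ x).2 := div_pos hy2 hx2
  refine ⟨_, ht, φ.injOn ?_ hy ?_⟩
  · rw [hsrc, mem_preimage, C.proj_dil _ ht]; exact hbU
  · rw [(hφ x hx).2 _ ht, div_mul_cancel₀ _ hx2.ne', h, ← (hφ y hy).1]

/-- A tangent vector annihilated by the differentials of the projection and of a positive function
of degree 1 is zero. -/
theorem eq_zero_of_mfderiv_proj_eq_zero [IsManifold IS ∞ S] [IsManifold IX ∞ X]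
    {r : S → ℝ} (hr : ContMDiff IS 𝓘(ℝ, ℝ) ∞ r)
    (hr0 : ∀ x, 0 < r x) (hr1 : ∀ t, 0 < t → ∀ x, r (C.dil t x) = t * r x) {x : S}
    {v : ES} (hv : (mfderiv IS IX C.proj x v : EX) = 0) (hrv : differential IS r x v = 0) :
    v = 0 := by
  obtain ⟨U, φ, hUo, hbU, hsrc, htgt, hsm, hsm', hφ⟩ := C.exists_trivialization (C.proj x)
  have hx : x ∈ φ.source := by rw [hsrc]; exact hbU
  have hx2 : 0 < (φ x).2 := by
    have := φ.map_source hx; rw [htgt] at this; exact this.2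
  have hnx : φ.source ∈ 𝓝 x := φ.open_source.mem_nhds hx
  have hφx : ContMDiffAt IS (IX.prod 𝓘(ℝ, ℝ)) ∞ φ x := hsm.contMDiffAt hnx
  have h2 : MDifferentiableAt IS 𝓘(ℝ, ℝ) (fun y => (φ y).2) x :=
    (contMDiff_snd.contMDiffAt.comp x hφx).mdifferentiableAt (by simp)
  have h1 : MDifferentiableAt IS IX (fun y => (φ y).1) x :=
    (contMDiff_fst.contMDiffAt.comp x hφx).mdifferentiableAt (by simp)
  have h1eq : mfderiv IS IX (fun y => (φ y).1) x = mfderiv IS IX C.proj x := by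
    apply Filter.EventuallyEq.mfderiv_eq
    filter_upwards [hnx] with y hy using (hφ y hy).1
  -- The trivialization is a diffeomorphism whose components are the projection and the fibre
  -- coordinate, so a vector killed by both differentials vanishes.
  have key : ∀ u : ES, (mfderiv IS IX C.proj x u : EX) = 0 →
      differential IS (fun y => (φ y).2) x u = 0 → u = 0 := by
    intro u hu1 hu2
    have hp : mfderiv IS (IX.prod 𝓘(ℝ, ℝ)) φ x =
        (mfderiv IS IX (fun y => (φ y).1) x).prod (mfderiv IS 𝓘(ℝ, ℝ) (fun y => (φ y).2) x) :=
      mfderiv_prodMk h1 h2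
    have hφ0 : (mfderiv IS (IX.prod 𝓘(ℝ, ℝ)) φ x u : EX × ℝ) = 0 := by
      rw [hp, h1eq]
      exact Prod.ext hu1 hu2
    have hs : MDifferentiableAt (IX.prod 𝓘(ℝ, ℝ)) IS φ.symm (φ x) :=
      (hsm'.contMDiffAt (φ.open_target.mem_nhds (φ.map_source hx))).mdifferentiableAt (by simp)
    have hc := mfderiv_comp x hs (hφx.mdifferentiableAt (by simp))
    have hid : mfderiv IS IS (φ.symm ∘ φ) x = mfderiv IS IS id x := by
      apply Filter.EventuallyEq.mfderiv_eq
      filter_upwards [hnx] with y hy using φ.left_inv hy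
    rw [hid, mfderiv_id] at hc
    have hcu := congrArg (fun L : ES →L[ℝ] ES => L u) hc
    refine hcu.trans ?_
    change (mfderiv (IX.prod 𝓘(ℝ, ℝ)) IS φ.symm (φ x) : EX × ℝ →L[ℝ] ES)
      (mfderiv IS (IX.prod 𝓘(ℝ, ℝ)) φ x u : EX × ℝ) = 0
    rw [hφ0, map_zero]
  -- With this c the vector v − cρ is killed by the projection and by the fibre coordinate, so v =
  -- cρ. Then 0 = dr(v) = c r(x) gives c = 0.
  set c := differential IS (fun y => (φ y).2) x v / (φ x).2 with hc
  set ρ : ES := C.radialField x with hρ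
  have hvc : v - c • ρ = 0 := by
    apply key
    · have hp := C.mfderiv_proj_radialField x
      have hlin : ∀ (L : ES →L[ℝ] EX), L v = 0 → L ρ = 0 → L (v - c • ρ) = 0 := by
        intro L h h'
        rw [map_sub, map_smul, h, h', smul_zero, sub_zero]
      exact hlin (mfderiv IS IX C.proj x) hv hp
    · rw [map_sub, map_smul, hρ, C.differential_radialField_of_degree_one h2, hc, smul_eq_mul,
        div_mul_cancel₀ _ hx2.ne', sub_self]
      intro t ht
      rw [(hφ x hx).2 t ht]
  have hvρ : v = c • ρ := sub_eq_zero.1 hvc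
  rw [hvρ, map_smul, hρ, C.differential_radialField_of_degree_one
    (hr.mdifferentiable (by simp) x) (fun t ht => hr1 t ht x), smul_eq_mul] at hrv
  rw [hvρ, (mul_eq_zero.1 hrv).resolve_right (hr0 x).ne', zero_smul]

section LieDerivative

variable [IsManifold IS ∞ S]

theorem _root_.pullbackOneForm_comp (w : SmoothOneForm IS S) {f g : S → S} {x : S}
    (hf : MDifferentiableAt IS IS f (g x)) (hg : MDifferentiableAt IS IS g x)
    (v : TangentSpace IS x) :
    pullbackOneForm (f ∘ g) w x v = pullbackOneForm f w (g x) (mfderiv IS IS g x v) := by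
  rw [pullbackOneForm, mfderiv_comp x hf hg]
  rfl

theorem _root_.pullbackOneForm_id (w : SmoothOneForm IS S) (x : S) (v : TangentSpace IS x) :
    pullbackOneForm id w x v = w x v := by
  rw [pullbackOneForm, mfderiv_id]
  rfl

/-- A form homogeneous of degree 1 is multiplied by `t` when pulled back by `dil t`. -/
theorem pullbackOneForm_dil {w : SmoothOneForm IS S} (hw : C.HasRadialLieDeriv w w) {t : ℝ}
    (ht : 0 < t) (x : S) (v : TangentSpace IS x) :
    pullbackOneForm (C.dil t) w x v = t * w x v := by
  set h : ℝ → ℝ := fun s => pullbackOneForm (C.dil (Real.exp s)) w x v with hh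
  -- The hypothesis gives derivatives at time 0 only. The flow property turns time s at x into time
  -- 0 at `dil (exp s) x`, whence h' = h everywhere and h is a multiple of exp.
  have hadd : ∀ s s', h (s + s') = pullbackOneForm (C.dil (Real.exp s')) w (C.dil (Real.exp s) x)
      (mfderiv IS IS (C.dil (Real.exp s)) x v) := by
    intro s s'
    have h1 : C.dil (Real.exp (s + s')) = C.dil (Real.exp s') ∘ C.dil (Real.exp s) := by
      funext y
      rw [add_comm, Real.exp_add, C.dil_mul _ _ (Real.exp_pos _) (Real.exp_pos _)]; rfl
    rw [hh]
    simp only [h1]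
    rw [pullbackOneForm_comp w ((C.contMDiff_dil (Real.exp_pos _)).mdifferentiable (by simp) _)
      ((C.contMDiff_dil (Real.exp_pos _)).mdifferentiable (by simp) _)]
  have hderiv : ∀ s, HasDerivAt h (h s) s := by
    intro s
    have h1 := hw (C.dil (Real.exp s) x) (mfderiv IS IS (C.dil (Real.exp s)) x v)
    simp only [← hadd] at h1
    have h2 : HasDerivAt (fun y => h (s + (y - s))) (h s) s := by
      have := HasDerivAt.comp_sub_const s s (f := fun y => h (s + y)) (f' := h s)
        (by rw [sub_self]; exact h1)
      exact this
    simpa using h2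
  have h0 : h 0 = w x v := by
    have : C.dil (Real.exp 0) = id := by funext y; rw [Real.exp_zero, C.dil_one]; rfl
    simp only [hh, this, pullbackOneForm_id]
  have hconst : ∀ s, h s * Real.exp (-s) = h 0 * Real.exp (-0) := by
    intro s
    refine is_const_of_deriv_eq_zero (f := fun s => h s * Real.exp (-s)) ?_ ?_ s 0
    · exact fun s => ((hderiv s).mul (hasDerivAt_neg s).exp).differentiableAt
    · intro s
      refine ((hderiv s).mul (hasDerivAt_neg s).exp).deriv.trans ?_
      ring
  have := hconst (Real.log t)
  rw [neg_zero, Real.exp_zero, mul_one, h0, Real.exp_neg, Real.exp_log ht] at this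
  have hl : h (Real.log t) = pullbackOneForm (C.dil t) w x v := by
    simp only [hh, Real.exp_log ht]
  rw [← hl, ← this]
  field_simp

end LieDerivative

end SmoothCone

/-! ### Functions of degree one and compactness -/

namespace SmoothCone

variable
    {ES : Type*} [NormedAddCommGroup ES] [NormedSpace ℝ ES] {HS : Type*} [TopologicalSpace HS]
    {IS : ModelWithCorners ℝ ES HS}
    {EX : Type*} [NormedAddCommGroup EX] [NormedSpace ℝ EX] [FiniteDimensional ℝ EX]
    {HX : Type*} [TopologicalSpace HX]
    {IX : ModelWithCorners ℝ EX HX}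
    {S : Type*} [TopologicalSpace S] [ChartedSpace HS S]
    {X : Type*} [TopologicalSpace X] [ChartedSpace HX X] [IsManifold IX ∞ X] [T2Space X]
    [CompactSpace X]
    (C : SmoothCone IS IX S X)

/-- On a cone with compact base there is a positive smooth function of degree 1, and a compact set
that meets all the fibres. -/
theorem exists_degree_one_and_compact :
    (∃ r : S → ℝ, ContMDiff IS 𝓘(ℝ, ℝ) ∞ r ∧ (∀ x, 0 < r x) ∧
      ∀ t, 0 < t → ∀ x, r (C.dil t x) = t * r x) ∧
    ∃ K : Set S, IsCompact K ∧ ∀ x, ∃ k ∈ K, C.proj k = C.proj x := by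
  choose U φ hUo hbU hsrc htgt hsm hsm' hφ using C.exists_trivialization
  have hpos : ∀ b, ∀ x ∈ (φ b).source, 0 < (φ b x).2 := by
    intro b x hx
    have := (φ b).map_source hx; rw [htgt] at this; exact this.2
  obtain ⟨T, hT⟩ := isCompact_univ.elim_finite_subcover U hUo fun b _ => mem_iUnion.2 ⟨b, hbU b⟩
  obtain ⟨p, hp⟩ := SmoothPartitionOfUnity.exists_isSubordinate IX (isClosed_univ (X := X))
    (fun b : T => U b) (fun b => hUo b) (by rwa [iUnion_subtype])
  have hex : ∀ q : X, ∃ b : T, 0 < p b q := by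
    intro q
    by_contra! h
    have h0 : ∀ b, p b q = 0 := fun b => le_antisymm (h b) (p.nonneg b q)
    have := p.sum_eq_one (mem_univ q)
    simp [h0] at this
  have hmem : ∀ (b : T) (q : X), p b q ≠ 0 → q ∈ U b := fun b q h =>
    hp b (subset_tsupport _ h)
  -- The fibre coordinates, each positive of degree 1, are glued by a partition of unity pulled back
  -- from the base; its members are constant along fibres, so the degree is preserved.
  refine ⟨⟨fun x => ∑ b : T, p b (C.proj x) * (φ b x).2, ?_, ?_, ?_⟩, ?_⟩
  · apply contMDiff_finsetSum
    intro b _ x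
    by_cases hx : C.proj x ∈ U b
    · have hn : (φ b).source ∈ 𝓝 x := (φ b).open_source.mem_nhds (by rw [hsrc]; exact hx)
      exact ((p b).contMDiff.comp C.contMDiff_proj x).mul
        (contMDiff_snd.contMDiffAt.comp x ((hsm b).contMDiffAt hn))
    -- Outside its source `φ b` carries no information, but there the weight vanishes on a whole
    -- neighbourhood.
    · have hn : (C.proj ⁻¹' (tsupport (p b))ᶜ) ∈ 𝓝 x :=
        ((isClosed_tsupport _).isOpen_compl.preimage C.contMDiff_proj.continuous).mem_nhds
          fun h => hx (hp b h)
      refine (contMDiffAt_const (c := (0 : ℝ))).congr_of_eventuallyEq ?_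
      filter_upwards [hn] with y hy
      rw [image_eq_zero_of_notMem_tsupport hy, zero_mul]
  · intro x
    obtain ⟨b, hb⟩ := hex (C.proj x)
    refine Finset.sum_pos' (fun c _ => ?_) ⟨b, Finset.mem_univ b, ?_⟩
    · by_cases hc : p c (C.proj x) = 0
      · simp [hc]
      · exact mul_nonneg (p.nonneg c _)
          (hpos c x (by rw [hsrc]; exact hmem c _ hc)).le
    · exact mul_pos hb (hpos b x (by rw [hsrc]; exact hmem b _ hb.ne'))
  · intro t ht x
    rw [Finset.mul_sum]
    refine Finset.sum_congr rfl fun b _ => ?_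
    rw [C.proj_dil t ht]
    by_cases hc : p b (C.proj x) = 0
    · simp [hc]
    · rw [(hφ b x (by rw [hsrc]; exact hmem b _ hc)).2 t ht]
      ring
  -- The compact set is the union of the local sections at height 1 over the supports of the
  -- partition.
  · refine ⟨⋃ b : T, (φ b).symm '' (tsupport (p b) ×ˢ {1}), isCompact_iUnion fun b => ?_, ?_⟩
    · refine ((isClosed_tsupport _).isCompact.prod isCompact_singleton).image_of_continuousOn ?_
      refine (φ b).continuousOn_symm.mono ?_
      rw [htgt]
      exact prod_mono (hp b) (by simp)
    · intro x
      obtain ⟨b, hb⟩ := hex (C.proj x)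
      have ht : (C.proj x, (1 : ℝ)) ∈ (φ b).target := by
        rw [htgt]; exact ⟨hmem b _ hb.ne', mem_Ioi.2 (one_pos (α := ℝ))⟩
      refine ⟨(φ b).symm (C.proj x, 1), mem_iUnion.2 ⟨b, mem_image_of_mem _
        ⟨subset_tsupport _ hb.ne', rfl⟩⟩, ?_⟩
      rw [← (hφ b _ ((φ b).map_target ht)).1, (φ b).right_inv ht]

/-- S is swept out from a compact set by the ratios (0, ∞) = exp ℝ. This is what makes partitions of
unity on S available. -/
theorem sigmaCompactSpace (C : SmoothCone IS IX S X) : SigmaCompactSpace S := by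
  obtain ⟨-, K, hK, hKX⟩ := C.exists_degree_one_and_compact
  have hsurj : (fun q : ℝ × S => C.dil q.1 q.2) '' (Ioi 0 ×ˢ K) = univ := by
    refine eq_univ_of_forall fun x => ?_
    obtain ⟨k, hk, hkx⟩ := hKX x
    obtain ⟨t, ht, htx⟩ := C.exists_dil_eq_of_proj_eq hkx
    exact ⟨(t, k), ⟨ht, hk⟩, htx⟩
  have hσ : IsSigmaCompact ((Real.exp '' univ) ×ˢ K) := by
    have h1 : IsSigmaCompact (Real.exp '' univ) :=
      isSigmaCompact_univ.image Real.continuous_exp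
    obtain ⟨A, hA, hAu⟩ := h1
    refine ⟨fun n => A n ×ˢ K, fun n => (hA n).prod hK, ?_⟩
    rw [← hAu, iUnion_prod_const]
  rw [image_univ, Real.range_exp] at hσ
  rw [← isSigmaCompact_univ_iff, ← hsurj]
  exact hσ.image_of_continuousOn (C.contMDiffOn_dil.continuousOn.mono
    (prod_mono subset_rfl (subset_univ K)))

/-- The level set `r = 1` of a positive continuous function of degree 1 is compact. -/
theorem isCompact_level {r : S → ℝ} (hr : Continuous r)
    (hr0 : ∀ x, 0 < r x) (hr1 : ∀ t, 0 < t → ∀ x, r (C.dil t x) = t * r x) :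
    IsCompact {x | r x = 1} := by
  obtain ⟨-, K, hK, hKX⟩ := C.exists_degree_one_and_compact
  have himg : (fun x => C.dil (r x)⁻¹ x) '' K = {x | r x = 1} := by
    ext x
    constructor
    · rintro ⟨k, hk, rfl⟩
      change r _ = 1
      rw [hr1 _ (inv_pos.2 (hr0 k)), inv_mul_cancel₀ (hr0 k).ne']
    · intro hx
      obtain ⟨k, hk, hkx⟩ := hKX x
      obtain ⟨t, ht, rfl⟩ := C.exists_dil_eq_of_proj_eq hkx
      have hx' : t * r k = 1 := by rw [← hr1 t ht]; exact hx
      exact ⟨k, hk, by simp only [← eq_inv_of_mul_eq_one_left hx']⟩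
  rw [← himg]
  refine hK.image ?_
  exact C.contMDiffOn_dil.continuousOn.comp_continuous
    ((hr.inv₀ fun x => (hr0 x).ne').prodMk continuous_id)
    fun x => ⟨inv_pos.2 (hr0 x), mem_univ _⟩

end SmoothCone

/-! ### Orthogonal representations in matrix form -/

/-- A continuous orthogonal representation in matrix form. -/
structure IsOrthogonalMatrixRep {G : Type*} [Group G] [TopologicalSpace G] {ι : Type*} [Fintype ι]
    [DecidableEq ι] (M : G → Matrix ι ι ℝ) : Prop where
  map_one : M 1 = 1
  map_mul : ∀ g h, M (g * h) = M g * M h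
  transpose : ∀ g, (M g).transpose = M g⁻¹
  continuous : Continuous M

namespace IsOrthogonalMatrixRep

variable {G : Type*} [Group G] [TopologicalSpace G] {ι : Type*} [Fintype ι] [DecidableEq ι]
  {M : G → Matrix ι ι ℝ}

theorem transpose_mul_self (hM : IsOrthogonalMatrixRep M) (g : G) :
    (M g).transpose * M g = 1 := by
  rw [hM.transpose, ← hM.map_mul, inv_mul_cancel, hM.map_one]

theorem mul_transpose_self (hM : IsOrthogonalMatrixRep M) (g : G) :
    M g * (M g).transpose = 1 := by
  rw [hM.transpose, ← hM.map_mul, mul_inv_cancel, hM.map_one]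

theorem dotProduct_mulVec (hM : IsOrthogonalMatrixRep M) (g : G) (u v : ι → ℝ) :
    (M g).mulVec u ⬝ᵥ (M g).mulVec v = u ⬝ᵥ v := by
  rw [Matrix.dotProduct_mulVec, Matrix.vecMul_mulVec, hM.transpose_mul_self, Matrix.vecMul_one]

theorem blockDiagonal (hM : IsOrthogonalMatrixRep M) (κ : Type*) [Fintype κ] [DecidableEq κ] :
    IsOrthogonalMatrixRep fun g => Matrix.blockDiagonal fun _ : κ => M g where
  map_one := by
    simp only [hM.map_one]
    exact Matrix.blockDiagonal_one
  map_mul g h := by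
    rw [← Matrix.blockDiagonal_mul]; simp only [hM.map_mul]
  transpose g := by
    rw [Matrix.blockDiagonal_transpose]; simp only [hM.transpose]
  continuous := Continuous.matrix_blockDiagonal (continuous_pi fun _ => hM.continuous)

theorem fromBlocks_one (hM : IsOrthogonalMatrixRep M) (κ : Type*) [Fintype κ] [DecidableEq κ] :
    IsOrthogonalMatrixRep fun g => Matrix.fromBlocks (M g) 0 0 (1 : Matrix κ κ ℝ) where
  map_one := by rw [hM.map_one, Matrix.fromBlocks_one]
  map_mul g h := by rw [Matrix.fromBlocks_multiply]; simp [hM.map_mul]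
  transpose g := by rw [Matrix.fromBlocks_transpose]; simp [hM.transpose]
  continuous := hM.continuous.matrix_fromBlocks continuous_const continuous_const continuous_const

theorem reindex (hM : IsOrthogonalMatrixRep M) {κ : Type*} [Fintype κ] [DecidableEq κ]
    (e : ι ≃ κ) : IsOrthogonalMatrixRep fun g => (M g).submatrix e.symm e.symm where
  map_one := by rw [hM.map_one, Matrix.submatrix_one_equiv]
  map_mul g h := by rw [Matrix.submatrix_mul_equiv, hM.map_mul]
  transpose g := by rw [Matrix.transpose_submatrix, hM.transpose]
  continuous := hM.continuous.matrix_submatrix _ _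

/-- The group homomorphism defined by a matrix representation. -/
def toMonoidHom (hM : IsOrthogonalMatrixRep M) : G →* Matrix.orthogonalGroup ι ℝ where
  toFun g := ⟨M g, (Matrix.mem_orthogonalGroup_iff ι ℝ).2 (hM.mul_transpose_self g)⟩
  map_one' := Subtype.ext hM.map_one
  map_mul' g h := Subtype.ext (hM.map_mul g h)

theorem continuous_toMonoidHom (hM : IsOrthogonalMatrixRep M) : Continuous hM.toMonoidHom :=
  hM.continuous.subtype_mk _

end IsOrthogonalMatrixRep

/-- A finite-dimensional invariant subspace of an isometric representation, in an orthonormal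
basis. -/
theorem exists_orthogonalMatrixRep_of_invariant {G : Type*} [Group G] [TopologicalSpace G]
    {H : Type*} [NormedAddCommGroup H] [InnerProductSpace ℝ H]
    (τ : G →* (H ≃ₗᵢ[ℝ] H)) (hτ : ∀ u, Continuous fun g => τ g u)
    (V : Submodule ℝ H) [FiniteDimensional ℝ V] (hV : ∀ g, ∀ u ∈ V, τ g u ∈ V) :
    ∃ (d : ℕ) (e : Fin d → H) (M : G → Matrix (Fin d) (Fin d) ℝ), IsOrthogonalMatrixRep M ∧
      (∀ D : H, (∀ i, inner ℝ (e i) D = 0) → ∀ u ∈ V, inner ℝ u D = 0) ∧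
      (∀ i, e i ∈ V) ∧
      ∀ g u i, inner ℝ (e i) (τ g u) = ∑ j, M g i j * inner ℝ (e j) u := by
  set b := stdOrthonormalBasis ℝ V with hb
  have hexp : ∀ u ∈ V, u = ∑ j, (inner ℝ (b j : H) u) • (b j : H) := by
    intro u hu
    have := congrArg (Subtype.val) (b.sum_repr' ⟨u, hu⟩)
    simpa using this.symm
  have hmul : ∀ g h (u : H), τ (g * h) u = τ g (τ h u) := fun g h u => by rw [map_mul]; rfl
  have hadj : ∀ g (u v : H), inner ℝ u (τ g v) = inner ℝ (τ g⁻¹ u) v := by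
    intro g u v
    rw [← LinearIsometryEquiv.inner_map_map (τ g) (τ g⁻¹ u) v, ← hmul, mul_inv_cancel, map_one]
    rfl
  -- After g is moved to the other side, only τ g⁻¹ (b i), which stays in V, is expanded in the
  -- basis; u itself may lie outside V.
  have hform : ∀ g u i, inner ℝ (b i : H) (τ g u)
      = ∑ j, inner ℝ (b i : H) (τ g (b j)) * inner ℝ (b j : H) u := by
    intro g u i
    rw [hadj, hexp (τ g⁻¹ (b i)) (hV _ _ (b i).2), sum_inner]
    refine Finset.sum_congr rfl fun j _ => ?_
    rw [real_inner_smul_left, hadj g, real_inner_comm]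
  refine ⟨_, fun i => (b i : H), fun g => Matrix.of fun i j => inner ℝ (b i : H) (τ g (b j)),
    ⟨?_, ?_, ?_, ?_⟩, ?_, fun i => (b i).2, hform⟩
  · ext i j
    simp only [map_one, Matrix.of_apply, LinearIsometryEquiv.coe_one, id]
    have := orthonormal_iff_ite.1 b.orthonormal i j
    rw [Submodule.coe_inner] at this
    rw [this, Matrix.one_apply]
  · intro g h
    ext i k
    rw [Matrix.mul_apply]
    simp only [Matrix.of_apply, hmul]
    exact hform g _ i
  · intro g
    ext i j
    simp only [Matrix.transpose_apply, Matrix.of_apply]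
    rw [hadj, real_inner_comm]
  · exact continuous_matrix fun i j => continuous_const.inner (hτ _)
  · intro D hD u hu
    rw [hexp u hu, sum_inner]
    exact Finset.sum_eq_zero fun j _ => by rw [real_inner_smul_left, hD, mul_zero]

/-! ### The left regular representation on L²(G) -/

section LeftRegular

open MeasureTheory DomMulAct

variable {G : Type*} [Group G] [TopologicalSpace G] [IsTopologicalGroup G] [CompactSpace G]
  [SecondCountableTopology G] [MeasurableSpace G] [BorelSpace G]
  (μ : Measure G) [IsProbabilityMeasure μ] [μ.IsMulLeftInvariant]

/-- The left regular representation of a compact group. -/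
noncomputable def leftRegular : G →* (Lp ℝ 2 μ ≃ₗᵢ[ℝ] Lp ℝ 2 μ) where
  -- `DomMulAct` acts by precomposition and reverses products; the inverse restores the order,
  -- giving (g u)(h) = u(g⁻¹h).
  toFun g :=
    { toFun := fun u => mk g⁻¹ • u
      invFun := fun u => mk g • u
      map_add' := fun u v => smul_add _ u v
      map_smul' := fun c u => smul_comm _ c u
      left_inv := fun u => by
        change mk g • mk g⁻¹ • u = u
        rw [smul_smul, ← mk_mul, inv_mul_cancel, mk_one, one_smul]
      right_inv := fun u => by
        change mk g⁻¹ • mk g • u = u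
        rw [smul_smul, ← mk_mul, mul_inv_cancel, mk_one, one_smul]
      norm_map' := fun u => norm_smul_Lp _ u }
  map_one' := by
    ext1 u
    change mk (1 : G)⁻¹ • u = u
    rw [inv_one, mk_one, one_smul]
  map_mul' g h := by
    ext1 u
    change mk (g * h)⁻¹ • u = mk g⁻¹ • mk h⁻¹ • u
    rw [smul_smul, ← mk_mul, mul_inv_rev]

theorem continuous_leftRegular [T2Space G] (u : Lp ℝ 2 μ) :
    Continuous fun g => leftRegular μ g u := by
  have : Fact ((2 : ENNReal) ≠ ⊤) := ⟨by simp⟩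
  change Continuous fun g : G => mk g⁻¹ • u
  exact (continuous_mk.comp continuous_inv).smul continuous_const

theorem leftRegular_toLp (g : G) (D : C(G, ℝ)) :
    leftRegular μ g (ContinuousMap.toLp 2 μ ℝ D)
      = ContinuousMap.toLp 2 μ ℝ ⟨fun h => D (g⁻¹ * h), by fun_prop⟩ := by
  change mk g⁻¹ • (ContinuousMap.toLp 2 μ ℝ D) = _
  apply Lp.ext
  filter_upwards [smul_Lp_ae_eq (mk g⁻¹) (ContinuousMap.toLp 2 μ ℝ D),
    ContinuousMap.coeFn_toLp (𝕜 := ℝ) μ (p := 2) (⟨fun h => D (g⁻¹ * h), by fun_prop⟩ : C(G, ℝ)),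
    (measurePreserving_mul_left μ g⁻¹).quasiMeasurePreserving.ae
      (ContinuousMap.coeFn_toLp (𝕜 := ℝ) μ (p := 2) D)] with h h1 h2 h3
  rw [h1, h2]
  exact h3

theorem inner_toLp (u : Lp ℝ 2 μ) (D : C(G, ℝ)) :
    inner ℝ u (ContinuousMap.toLp 2 μ ℝ D) = ∫ g, u g • D g ∂μ := by
  rw [L2.inner_def]
  apply integral_congr_ae
  filter_upwards [ContinuousMap.coeFn_toLp (𝕜 := ℝ) μ (p := 2) D] with g hg
  rw [hg]
  simp [mul_comm]

theorem exists_invariant_inner_toLp_ne_zero [T2Space G] [μ.IsOpenPosMeasure] {D : C(G, ℝ)}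
    (hD : D ≠ 0) :
    ∃ V : Submodule ℝ (Lp ℝ 2 μ), FiniteDimensional ℝ V ∧
      (∀ g, ∀ u ∈ V, leftRegular μ g u ∈ V) ∧
      ∃ e ∈ V, inner ℝ e (ContinuousMap.toLp 2 μ ℝ D) ≠ 0 := by
  refine exists_finiteDimensional_invariant_inner_ne_zero μ (leftRegular μ)
    (continuous_leftRegular μ) _ fun h => hD ?_
  exact ContinuousMap.toLp_injective μ (by rw [h, map_zero])

end LeftRegular

/-! ### Rules for the differential -/

section Differential

variable {ES : Type*} [NormedAddCommGroup ES] [NormedSpace ℝ ES]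
  {HS : Type*} [TopologicalSpace HS] {IS : ModelWithCorners ℝ ES HS}
  {S : Type*} [TopologicalSpace S] [ChartedSpace HS S]
  {F : Type*} [NormedAddCommGroup F] [NormedSpace ℝ F]
  {F' : Type*} [NormedAddCommGroup F'] [NormedSpace ℝ F']

theorem differential_comp_of_hasFDerivAt {f : S → F} {x : S}
    (hf : MDifferentiableAt IS 𝓘(ℝ, F) f x)
    {φ : F → F'} {φ' : F →L[ℝ] F'} (hφ : HasFDerivAt φ φ' (f x)) (v : ES) :
    differential IS (fun y => φ (f y)) x v = φ' (differential IS f x v) := by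
  have h := hφ.hasMFDerivAt.comp x hf.hasMFDerivAt
  have h2 : mfderiv IS 𝓘(ℝ, F') (φ ∘ f) x = _ := h.mfderiv
  exact congrArg (fun L : ES →L[ℝ] F' => L v) h2

theorem differential_clm_comp {f : S → F} {x : S} (hf : MDifferentiableAt IS 𝓘(ℝ, F) f x)
    (L : F →L[ℝ] F') (v : ES) :
    differential IS (fun y => L (f y)) x v = L (differential IS f x v) :=
  differential_comp_of_hasFDerivAt hf L.hasFDerivAt v

theorem differential_comp_self_map {f : S → F} {φ : S → S} {x : S}
    (hf : MDifferentiableAt IS 𝓘(ℝ, F) f (φ x)) (hφ : MDifferentiableAt IS IS φ x) (v : ES) :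
    differential IS (fun y => f (φ y)) x v = differential IS f (φ x) (mfderiv IS IS φ x v) := by
  have h2 : mfderiv IS 𝓘(ℝ, F) (f ∘ φ) x = _ := mfderiv_comp x hf hφ
  exact congrArg (fun L : ES →L[ℝ] F => L v) h2

theorem differential_const (c : F) (x : S) (v : ES) :
    differential IS (fun _ : S => c) x v = 0 := by
  have h : mfderiv IS 𝓘(ℝ, F) (fun _ : S => c) x = _ := mfderiv_const
  exact congrArg (fun L : ES →L[ℝ] F => L v) h

end Differential

/-! ### Integrals along orbits -/

section OrbitIntegral

open MeasureTheory

variable {EG : Type*} [NormedAddCommGroup EG] [NormedSpace ℝ EG]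
  {G : Type*} [Group G] [TopologicalSpace G] [ChartedSpace EG G] [LieGroup 𝓘(ℝ, EG) ∞ G]
  {ES : Type*} [NormedAddCommGroup ES] [NormedSpace ℝ ES]
  {HS : Type*} [TopologicalSpace HS] {IS : ModelWithCorners ℝ ES HS}
  {S : Type*} [TopologicalSpace S] [ChartedSpace HS S]
  {F : Type*} [NormedAddCommGroup F] [NormedSpace ℝ F]
  [MulAction G S] [ContMDiffSMul 𝓘(ℝ, EG) IS ∞ G S]

variable (EG) in
theorem contMDiff_uncurry_inv_smul {f : S → F} (hf : ContMDiff IS 𝓘(ℝ, F) ∞ f) :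
    ContMDiff (𝓘(ℝ, EG).prod IS) 𝓘(ℝ, F) ∞ (Function.uncurry fun (g : G) x => f (g⁻¹ • x)) := by
  have h1 : ContMDiff (𝓘(ℝ, EG).prod IS) IS ∞ (fun p : G × S => p.1⁻¹ • p.2) :=
    (contMDiff_smul (I := 𝓘(ℝ, EG)) (I' := IS)).comp
      (((contMDiff_inv 𝓘(ℝ, EG) ∞).comp contMDiff_fst).prodMk contMDiff_snd)
  exact hf.comp h1

/-- The integral of a function along the orbits of a group action, against a weight. -/
noncomputable def orbitIntegral [MeasurableSpace G] (μ : Measure G) (c : G → ℝ) (f : S → F)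
    (x : S) : F :=
  ∫ g, c g • f (g⁻¹ • x) ∂μ

variable [CompactSpace G] [SecondCountableTopology G] [MeasurableSpace G] [BorelSpace G]
  (μ : Measure G) [IsProbabilityMeasure μ]

variable [FiniteDimensional ℝ ES] [CompleteSpace F] [IsManifold IS ∞ S]

include EG in
variable (EG) in
theorem contMDiff_orbitIntegral {c : G → ℝ} (hc : Integrable c μ) {f : S → F}
    (hf : ContMDiff IS 𝓘(ℝ, F) ∞ f) : ContMDiff IS 𝓘(ℝ, F) ∞ (orbitIntegral μ c f) :=
  contMDiff_integral_smul hc (contMDiff_uncurry_inv_smul EG hf)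

include EG in
variable (EG) in
theorem differential_orbitIntegral {c : G → ℝ} (hc : Integrable c μ) {f : S → F}
    (hf : ContMDiff IS 𝓘(ℝ, F) ∞ f) (x : S) (v : ES) :
    differential IS (orbitIntegral μ c f) x v
      = ∫ g, c g • differential IS (fun y => f (g⁻¹ • y)) x v ∂μ :=
  differential_integral_smul hc (contMDiff_uncurry_inv_smul EG hf) x v

variable (EG) in
/-- The restriction of a smooth function to an orbit. -/
noncomputable def orbitMap {f : S → ℝ} (hf : ContMDiff IS 𝓘(ℝ, ℝ) ∞ f) (x : S) : C(G, ℝ) where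
  toFun g := f (g⁻¹ • x)
  continuous_toFun := (contMDiff_uncurry_inv_smul EG hf).continuous.comp
    (continuous_id.prodMk continuous_const)

variable (EG) in
/-- The differential of a smooth function along an orbit. -/
noncomputable def orbitDifferential {f : S → ℝ} (hf : ContMDiff IS 𝓘(ℝ, ℝ) ∞ f) (x : S) (v : ES) :
    C(G, ℝ) where
  toFun g := differential IS (fun y => f (g⁻¹ • y)) x v
  continuous_toFun := (continuous_differential_of_uncurry
    (contMDiff_uncurry_inv_smul EG hf) x).clm_apply continuous_const

variable [IsTopologicalGroup G] [μ.IsMulLeftInvariant]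

/-- As an L² pairing the orbit integral has its weight separated from the point. Since x ↦
`orbitMap` is equivariant for the left regular representation, weights from an invariant subspace
give equivariant maps. -/
theorem orbitIntegral_eq_inner {f : S → ℝ} (hf : ContMDiff IS 𝓘(ℝ, ℝ) ∞ f) (x : S)
    (u : Lp ℝ 2 μ) :
    orbitIntegral μ u f x = inner ℝ u (ContinuousMap.toLp 2 μ ℝ (orbitMap EG hf x)) :=
  (inner_toLp μ u (orbitMap EG hf x)).symm

theorem integrable_coe_Lp_two (u : Lp ℝ 2 μ) : Integrable u μ :=
  (Lp.memLp u).integrable (by norm_num)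

theorem differential_orbitIntegral_eq_inner {f : S → ℝ} (hf : ContMDiff IS 𝓘(ℝ, ℝ) ∞ f) (x : S)
    (v : ES) (u : Lp ℝ 2 μ) :
    differential IS (orbitIntegral μ u f) x v
      = inner ℝ u (ContinuousMap.toLp 2 μ ℝ (orbitDifferential (G := G) EG hf x v)) := by
  rw [differential_orbitIntegral EG μ (integrable_coe_Lp_two μ u) hf, inner_toLp]
  rfl

theorem leftRegular_toLp_orbitMap {f : S → ℝ} (hf : ContMDiff IS 𝓘(ℝ, ℝ) ∞ f) (g : G) (x : S) :
    leftRegular μ g (ContinuousMap.toLp 2 μ ℝ (orbitMap EG hf x))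
      = ContinuousMap.toLp 2 μ ℝ (orbitMap EG hf (g • x)) := by
  rw [leftRegular_toLp]
  congr 1
  ext h
  change f ((g⁻¹ * h)⁻¹ • x) = f (h⁻¹ • g • x)
  rw [mul_inv_rev, inv_inv, mul_smul]

end OrbitIntegral

/-! ### The differential of the pair (r, w) -/

section ProductDifferential

variable {ES : Type*} [NormedAddCommGroup ES] [NormedSpace ℝ ES]
  {HS : Type*} [TopologicalSpace HS] {IS : ModelWithCorners ℝ ES HS}
  {S : Type*} [TopologicalSpace S] [ChartedSpace HS S]
  {ι : Type*} [Fintype ι]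

theorem contMDiff_prodMk_pi {r : S → ℝ} {w : S → ι → ℝ} (hr : ContMDiff IS 𝓘(ℝ, ℝ) ∞ r)
    (hw : ∀ i, ContMDiff IS 𝓘(ℝ, ℝ) ∞ fun x => w x i) :
    ContMDiff IS 𝓘(ℝ, ℝ × (ι → ℝ)) ∞ fun x => (r x, w x) :=
  hr.prodMk_space (contMDiff_pi_space.2 hw)

theorem differential_prodMk_pi {r : S → ℝ} {w : S → ι → ℝ} (hr : ContMDiff IS 𝓘(ℝ, ℝ) ∞ r)
    (hw : ∀ i, ContMDiff IS 𝓘(ℝ, ℝ) ∞ fun x => w x i) (x : S) (v : ES) :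
    differential IS (fun x => (r x, w x)) x v
      = (differential IS r x v, fun i => differential IS (fun x => w x i) x v) := by
  have h := (contMDiff_prodMk_pi hr hw).mdifferentiable (by simp) x
  refine Prod.ext ?_ (funext fun i => ?_)
  · exact (differential_clm_comp h (ContinuousLinearMap.fst ℝ ℝ (ι → ℝ)) v).symm
  · exact (differential_clm_comp h ((ContinuousLinearMap.proj i).comp
      (ContinuousLinearMap.snd ℝ ℝ (ι → ℝ))) v).symm

theorem differential_prodMk_pi_injective {r : S → ℝ} {w : S → ι → ℝ}
    (hr : ContMDiff IS 𝓘(ℝ, ℝ) ∞ r) (hw : ∀ i, ContMDiff IS 𝓘(ℝ, ℝ) ∞ fun x => w x i) {x : S}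
    (h : ∀ v : ES, differential IS r x v = 0 → (∀ i, differential IS (fun x => w x i) x v = 0) →
      v = 0) : Function.Injective (differential IS (fun x => (r x, w x)) x) := by
  refine (injective_iff_map_eq_zero _).2 fun v hv => ?_
  rw [differential_prodMk_pi hr hw] at hv
  exact h v (congrArg Prod.fst hv) fun i => congrFun (congrArg Prod.snd hv) i

end ProductDifferential

/-! ### From an injective immersion to an equivariant one -/

section EquivariantImmersion

open MeasureTheory

variable {EG : Type*} [NormedAddCommGroup EG] [NormedSpace ℝ EG]
  {G : Type*} [Group G] [TopologicalSpace G] [ChartedSpace EG G] [LieGroup 𝓘(ℝ, EG) ∞ G]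
  [CompactSpace G] [SecondCountableTopology G] [MeasurableSpace G] [BorelSpace G]
  [IsTopologicalGroup G]
  (μ : Measure G) [IsProbabilityMeasure μ] [μ.IsMulLeftInvariant]

/-- Finite-dimensional subspaces invariant under the left regular representation. -/
def IsFiniteInvariant (V : Submodule ℝ (Lp ℝ 2 μ)) : Prop :=
  FiniteDimensional ℝ V ∧ ∀ g, ∀ u ∈ V, leftRegular μ g u ∈ V

theorem isFiniteInvariant_bot : IsFiniteInvariant μ ⊥ :=
  ⟨inferInstance, fun g u hu => by
    rw [Submodule.mem_bot] at hu ⊢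
    rw [hu, map_zero]⟩

theorem IsFiniteInvariant.sup {V V' : Submodule ℝ (Lp ℝ 2 μ)} (h : IsFiniteInvariant μ V)
    (h' : IsFiniteInvariant μ V') : IsFiniteInvariant μ (V ⊔ V') := by
  have := h.1
  have := h'.1
  refine ⟨inferInstance, fun g u hu => ?_⟩
  obtain ⟨a, ha, b, hb, rfl⟩ := Submodule.mem_sup.1 hu
  rw [map_add]
  exact Submodule.add_mem_sup (h.2 g a ha) (h'.2 g b hb)

variable {ES : Type*} [NormedAddCommGroup ES] [NormedSpace ℝ ES]
  {HS : Type*} [TopologicalSpace HS] {IS : ModelWithCorners ℝ ES HS}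
  {S : Type*} [TopologicalSpace S] [ChartedSpace HS S]
  [MulAction G S] {κ : Type*}

/-- The orbit integrals with weights in `V`, together with `r`, distinguish `x` and `y`. -/
def OrbitSeparates (r : S → ℝ) (f : κ → S → ℝ) (V : Submodule ℝ (Lp ℝ 2 μ)) (x y : S) : Prop :=
  r x = r y → (∀ a, ∀ e ∈ V, orbitIntegral μ e (f a) x = orbitIntegral μ e (f a) y) → x = y

variable (IS) in
/-- The orbit integrals with weights in `V`, together with `r`, are immersive at `x`. -/
def OrbitImmersive (r : S → ℝ) (f : κ → S → ℝ) (V : Submodule ℝ (Lp ℝ 2 μ)) (x : S) : Prop :=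
  ∀ v : ES, differential IS r x v = 0 →
    (∀ a, ∀ e ∈ V, differential IS (orbitIntegral μ e (f a)) x v = 0) → v = 0

theorem OrbitSeparates.mono {r : S → ℝ} {f : κ → S → ℝ} {V V' : Submodule ℝ (Lp ℝ 2 μ)} {x y : S}
    (h : OrbitSeparates μ r f V x y) (hV : V ≤ V') : OrbitSeparates μ r f V' x y :=
  fun hr hf => h hr fun a e he => hf a e (hV he)

theorem OrbitImmersive.mono {r : S → ℝ} {f : κ → S → ℝ} {V V' : Submodule ℝ (Lp ℝ 2 μ)} {x : S}
    (h : OrbitImmersive μ IS r f V x) (hV : V ≤ V') : OrbitImmersive μ IS r f V' x :=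
  fun v hr hf => h v hr fun a e he => hf a e (hV he)

variable [ContMDiffSMul 𝓘(ℝ, EG) IS ∞ G S] [FiniteDimensional ℝ ES] [IsManifold IS ∞ S]
  {r : S → ℝ} {f : κ → S → ℝ}

-- Choose V with minimal common kernel N V, possible because ES is finite-dimensional. If v ≠ 0
-- remained in it, some df_a(v) would be nonzero, so g ↦ d(f_a(g⁻¹·))(v) would be a nonzero
-- function, its value at g = 1 being df_a(v). Peter–Weyl then supplies V' for which N (V ⊔ V') is
-- strictly smaller.
include EG in
variable (EG) in
theorem exists_orbitImmersive [T2Space G] [μ.IsOpenPosMeasure]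
    (hf : ∀ a, ContMDiff IS 𝓘(ℝ, ℝ) ∞ (f a)) {x : S}
    (h : ∀ v : ES, differential IS r x v = 0 → (∀ a, differential IS (f a) x v = 0) → v = 0) :
    ∃ V, IsFiniteInvariant μ V ∧ OrbitImmersive μ IS r f V x := by
  let N : Submodule ℝ (Lp ℝ 2 μ) → Submodule ℝ ES := fun V =>
    { carrier := {v | differential IS r x v = 0 ∧
        ∀ a, ∀ e ∈ V, differential IS (orbitIntegral μ e (f a)) x v = 0}
      zero_mem' := ⟨map_zero _, fun _ _ _ => map_zero _⟩
      add_mem' := fun {u v} hu hv => ⟨by rw [map_add, hu.1, hv.1, add_zero],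
        fun a e he => by rw [map_add, hu.2 a e he, hv.2 a e he, add_zero]⟩
      smul_mem' := fun c v hv => ⟨by rw [map_smul, hv.1, smul_zero],
        fun a e he => by rw [map_smul, hv.2 a e he, smul_zero]⟩ }
  obtain ⟨_, ⟨V, hV, rfl⟩, hmin⟩ := IsArtinian.set_has_minimal
    (N '' {V | IsFiniteInvariant μ V}) ⟨_, ⊥, isFiniteInvariant_bot μ, rfl⟩
  refine ⟨V, hV, fun v hrv hv => ?_⟩
  by_contra hne
  have : ∃ a, differential IS (f a) x v ≠ 0 := by
    by_contra! h0
    exact hne (h v hrv h0)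
  obtain ⟨a, ha⟩ := this
  have hD : orbitDifferential (G := G) EG (hf a) x v ≠ 0 := by
    intro h0
    have h1 : differential IS (fun y => f a ((1 : G)⁻¹ • y)) x v = 0 :=
      congrArg (fun D : C(G, ℝ) => D 1) h0
    simp only [inv_one, one_smul] at h1
    exact ha h1
  obtain ⟨V', hV'f, hV'i, e, he, hee⟩ := exists_invariant_inner_toLp_ne_zero μ hD
  refine hmin (N (V ⊔ V')) ⟨_, hV.sup μ ⟨hV'f, hV'i⟩, rfl⟩ (lt_of_le_not_ge ?_ ?_)
  · exact fun u hu => ⟨hu.1, fun b e he => hu.2 b e (Submodule.mem_sup_left he)⟩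
  · intro hle
    have hv' : v ∈ N (V ⊔ V') := hle ⟨hrv, hv⟩
    apply hee
    rw [← differential_orbitIntegral_eq_inner]
    exact hv'.2 a e (Submodule.mem_sup_right he)

-- If r does not separate x and y, some g ↦ f_a(g⁻¹x) − f_a(g⁻¹y) is nonzero at g = 1 and is
-- detected by Peter–Weyl. Separation by a continuous function is an open condition on the pair.
include EG in
variable (EG) in
theorem exists_eventually_orbitSeparates [T2Space G] [μ.IsOpenPosMeasure] (hr : Continuous r)
    (hf : ∀ a, ContMDiff IS 𝓘(ℝ, ℝ) ∞ (f a)) {x y : S} (hxy : x ≠ y)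
    (h : r x = r y → (∀ a, f a x = f a y) → x = y) :
    ∃ V, IsFiniteInvariant μ V ∧ ∀ᶠ p in 𝓝 (x, y), OrbitSeparates μ r f V p.1 p.2 := by
  have hc : ∀ {F : S → ℝ}, Continuous F → F x ≠ F y → ∀ᶠ p in 𝓝 (x, y), F p.1 ≠ F p.2 := by
    intro F hF hne
    exact ((hF.comp continuous_fst).continuousAt.ne_iff_eventually_ne
      (hF.comp continuous_snd).continuousAt).1 hne
  by_cases hrr : r x = r y
  · have : ∃ a, f a x ≠ f a y := by
      by_contra! h0
      exact hxy (h hrr h0)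
    obtain ⟨a, ha⟩ := this
    have hD : orbitMap (G := G) EG (hf a) x - orbitMap (G := G) EG (hf a) y ≠ 0 := by
      intro h0
      have h1 : f a ((1 : G)⁻¹ • x) - f a ((1 : G)⁻¹ • y) = 0 :=
        congrArg (fun D : C(G, ℝ) => D 1) h0
      simp only [inv_one, one_smul] at h1
      exact ha (sub_eq_zero.1 h1)
    obtain ⟨V, hVf, hVi, e, he, hee⟩ := exists_invariant_inner_toLp_ne_zero μ hD
    rw [map_sub, inner_sub_right, ← orbitIntegral_eq_inner, ← orbitIntegral_eq_inner] at hee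
    refine ⟨V, ⟨hVf, hVi⟩, ?_⟩
    filter_upwards [hc (contMDiff_orbitIntegral EG μ (integrable_coe_Lp_two μ e)
      (hf a)).continuous (sub_ne_zero.1 hee)] with p hp _ h2
    exact absurd (h2 a e he) hp
  · refine ⟨⊥, isFiniteInvariant_bot μ, ?_⟩
    filter_upwards [hc hr hrr] with p hp h1 _
    exact absurd h1 hp

variable [Fintype κ]

-- A basis of V turns immersivity at x into that of a finite-dimensional map, and an immersion at a
-- point is an injective immersion nearby. The injectivity serves to separate pairs close to the
-- diagonal.
include EG in
variable (EG) in
theorem exists_nhds_orbitImmersive [T2Space G] [μ.IsOpenPosMeasure]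
    (hr : ContMDiff IS 𝓘(ℝ, ℝ) ∞ r) (hf : ∀ a, ContMDiff IS 𝓘(ℝ, ℝ) ∞ (f a)) {x : S}
    (h : ∀ v : ES, differential IS r x v = 0 → (∀ a, differential IS (f a) x v = 0) → v = 0) :
    ∃ V, IsFiniteInvariant μ V ∧ ∃ U ∈ 𝓝 x, (∀ y ∈ U, OrbitImmersive μ IS r f V y) ∧
      ∀ y ∈ U, ∀ z ∈ U, OrbitSeparates μ r f V y z := by
  obtain ⟨V, hV, himm⟩ := exists_orbitImmersive EG μ hf h
  refine ⟨V, hV, ?_⟩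
  have := hV.1
  obtain ⟨d, e, -, -, hspan, heV, -⟩ := exists_orthogonalMatrixRep_of_invariant (leftRegular μ)
    (continuous_leftRegular μ) V hV.2
  set w : S → Fin d × κ → ℝ := fun y p => orbitIntegral μ (e p.1) (f p.2) y with hw
  have hws : ∀ p, ContMDiff IS 𝓘(ℝ, ℝ) ∞ fun y => w y p := fun p =>
    contMDiff_orbitIntegral EG μ (integrable_coe_Lp_two μ _) (hf p.2)
  have hinj : Function.Injective (differential IS (fun y => (r y, w y)) x) := by
    refine differential_prodMk_pi_injective hr hws fun v hrv hwv => himm v hrv fun a u hu => ?_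
    rw [differential_orbitIntegral_eq_inner (EG := EG) μ (hf a)]
    refine hspan _ (fun i => ?_) u hu
    rw [← differential_orbitIntegral_eq_inner]
    exact hwv (i, a)
  obtain ⟨U, hU, hUinj, hUimm, -⟩ := exists_nhds_immersion (contMDiff_prodMk_pi hr hws) hinj
  refine ⟨U, hU, fun y hy v hrv hwv => ?_, fun y hy z hz hryz hwyz => ?_⟩
  · apply (injective_iff_map_eq_zero _).1 (hUimm y hy)
    rw [differential_prodMk_pi hr hws, hrv]
    exact Prod.ext rfl (funext fun p => hwv p.2 (e p.1) (heV _))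
  · exact hUinj hy hz (Prod.ext hryz (funext fun p => hwyz p.2 (e p.1) (heV _)))

include EG in
variable (EG) in
/-- On a compact set, finitely many orbit integrals spanning an invariant space of functions are
enough to obtain an injective immersion. -/
theorem exists_orbitSeparates_orbitImmersive_on_compact [T2Space G] [μ.IsOpenPosMeasure]
    (hr : ContMDiff IS 𝓘(ℝ, ℝ) ∞ r) (hf : ∀ a, ContMDiff IS 𝓘(ℝ, ℝ) ∞ (f a))
    (hsep : ∀ x y, r x = r y → (∀ a, f a x = f a y) → x = y)
    (himm : ∀ (x : S) (v : ES), differential IS r x v = 0 →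
      (∀ a, differential IS (f a) x v = 0) → v = 0)
    {K : Set S} (hK : IsCompact K) :
    ∃ V, IsFiniteInvariant μ V ∧ (∀ x ∈ K, OrbitImmersive μ IS r f V x) ∧
      ∀ x ∈ K, ∀ y ∈ K, OrbitSeparates μ r f V x y := by
  have h1 : ∃ V, IsFiniteInvariant μ V ∧ ∀ x ∈ K, OrbitImmersive μ IS r f V x := by
    refine hK.induction_on (p := fun s => ∃ V, IsFiniteInvariant μ V ∧
      ∀ x ∈ s, OrbitImmersive μ IS r f V x) ⟨⊥, isFiniteInvariant_bot μ, by simp⟩ ?_ ?_ ?_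
    · rintro s t hst ⟨V, hV, h⟩
      exact ⟨V, hV, fun x hx => h x (hst hx)⟩
    · rintro s t ⟨V, hV, h⟩ ⟨V', hV', h'⟩
      refine ⟨V ⊔ V', hV.sup μ hV', fun x hx => hx.elim (fun hx => ?_) fun hx => ?_⟩
      · exact (h x hx).mono μ le_sup_left
      · exact (h' x hx).mono μ le_sup_right
    · intro x _
      obtain ⟨V, hV, U, hU, h, -⟩ := exists_nhds_orbitImmersive EG μ hr hf (himm x)
      exact ⟨U, mem_nhdsWithin_of_mem_nhds hU, V, hV, h⟩
  have h2 : ∃ V, IsFiniteInvariant μ V ∧ ∀ p ∈ K ×ˢ K, OrbitSeparates μ r f V p.1 p.2 := by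
    refine (hK.prod hK).induction_on (p := fun s => ∃ V, IsFiniteInvariant μ V ∧
      ∀ p ∈ s, OrbitSeparates μ r f V p.1 p.2) ⟨⊥, isFiniteInvariant_bot μ, by simp⟩ ?_ ?_ ?_
    · rintro s t hst ⟨V, hV, h⟩
      exact ⟨V, hV, fun x hx => h x (hst hx)⟩
    · rintro s t ⟨V, hV, h⟩ ⟨V', hV', h'⟩
      refine ⟨V ⊔ V', hV.sup μ hV', fun x hx => hx.elim (fun hx => ?_) fun hx => ?_⟩
      · exact (h x hx).mono μ le_sup_left
      · exact (h' x hx).mono μ le_sup_right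
    · rintro ⟨x, y⟩ _
      -- Diagonal points are covered by the local injectivity of an immersion, the others by
      -- separation of distinct points.
      by_cases hxy : x = y
      · subst hxy
        obtain ⟨V, hV, U, hU, -, h⟩ := exists_nhds_orbitImmersive EG μ hr hf (himm x)
        exact ⟨U ×ˢ U, mem_nhdsWithin_of_mem_nhds (prod_mem_nhds hU hU), V, hV,
          fun p hp => h p.1 hp.1 p.2 hp.2⟩
      · obtain ⟨V, hV, h⟩ := exists_eventually_orbitSeparates EG μ hr.continuous hf hxy (hsep x y)
        exact ⟨_, mem_nhdsWithin_of_mem_nhds h, V, hV, fun p hp => hp⟩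
  obtain ⟨V, hV, hVi⟩ := h1
  obtain ⟨V', hV', hVs⟩ := h2
  exact ⟨V ⊔ V', hV.sup μ hV', fun x hx => (hVi x hx).mono μ le_sup_left,
    fun x hx y hy => (hVs (x, y) ⟨hx, hy⟩).mono μ le_sup_right⟩

variable {EX : Type*} [NormedAddCommGroup EX] [NormedSpace ℝ EX]
  {HX : Type*} [TopologicalSpace HX] {IX : ModelWithCorners ℝ EX HX}
  {X : Type*} [TopologicalSpace X] [ChartedSpace HX X]

theorem orbitIntegral_dil (C : SmoothCone IS IX S X)
    (hcomm : ∀ (g : G) (t : ℝ), 0 < t → ∀ x : S, g • C.dil t x = C.dil t (g • x))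
    {f : S → ℝ} {k : ℝ} (c : G → ℝ) {t : ℝ} (ht : 0 < t)
    (hft : ∀ x, f (C.dil t x) = k * f x) (x : S) :
    orbitIntegral μ c f (C.dil t x) = k * orbitIntegral μ c f x := by
  rw [orbitIntegral, orbitIntegral, ← integral_const_mul]
  refine integral_congr_ae (.of_forall fun g => ?_)
  simp only [hcomm _ _ ht, hft, smul_eq_mul]
  ring

include EG in
variable (EG) in
/-- A cone with compact level sets of `r` has an equivariant map of degree zero to an orthogonal
representation which together with `r` is an injective immersion. -/
theorem exists_equivariant_injective_immersion [T2Space G] [μ.IsOpenPosMeasure]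
    (C : SmoothCone IS IX S X)
    (hcomm : ∀ (g : G) (t : ℝ), 0 < t → ∀ x : S, g • C.dil t x = C.dil t (g • x))
    (hr : ContMDiff IS 𝓘(ℝ, ℝ) ∞ r) (hr0 : ∀ x, 0 < r x)
    (hr1 : ∀ t, 0 < t → ∀ x, r (C.dil t x) = t * r x) (hK : IsCompact {x | r x = 1})
    (hf : ∀ a, ContMDiff IS 𝓘(ℝ, ℝ) ∞ (f a))
    (hf0 : ∀ a, ∀ t, 0 < t → ∀ x, f a (C.dil t x) = f a x)
    (hsep : ∀ x y, r x = r y → (∀ a, f a x = f a y) → x = y)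
    (himm : ∀ (x : S) (v : ES), differential IS r x v = 0 →
      (∀ a, differential IS (f a) x v = 0) → v = 0) [DecidableEq κ] :
    ∃ (d : ℕ) (M : G → Matrix (Fin d × κ) (Fin d × κ) ℝ) (w : S → Fin d × κ → ℝ),
      IsOrthogonalMatrixRep M ∧ (∀ i, ContMDiff IS 𝓘(ℝ, ℝ) ∞ fun x => w x i) ∧
      (∀ g x, w (g • x) = (M g).mulVec (w x)) ∧
      (∀ t, 0 < t → ∀ x, w (C.dil t x) = w x) ∧
      (∀ x y, r x = r y → w x = w y → x = y) ∧
      ∀ (x : S) (v : ES), differential IS r x v = 0 →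
        (∀ i, differential IS (fun y => w y i) x v = 0) → v = 0 := by
  obtain ⟨V, hV, hVi, hVs⟩ := exists_orbitSeparates_orbitImmersive_on_compact EG μ hr hf hsep himm
    hK
  have := hV.1
  obtain ⟨d, e, M, hM, hspan, heV, hMe⟩ := exists_orthogonalMatrixRep_of_invariant (leftRegular μ)
    (continuous_leftRegular μ) V hV.2
  -- Each f_a contributes one copy of the representation on V, so the matrices are block diagonal
  -- with κ equal blocks.
  set w : S → Fin d × κ → ℝ := fun y p => orbitIntegral μ (e p.1) (f p.2) y with hw
  have hws : ∀ p, ContMDiff IS 𝓘(ℝ, ℝ) ∞ fun y => w y p := fun p =>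
    contMDiff_orbitIntegral EG μ (integrable_coe_Lp_two μ _) (hf p.2)
  have hw0 : ∀ t, 0 < t → ∀ x, w (C.dil t x) = w x := fun t ht x => funext fun p => by
    rw [hw]
    exact (orbitIntegral_dil μ C hcomm (k := 1) _ ht
      (fun x => by rw [hf0 _ _ ht, one_mul]) x).trans (one_mul _)
  have hmem : ∀ x, C.dil (r x)⁻¹ x ∈ {x | r x = 1} := fun x => by
    change r _ = 1
    rw [hr1 _ (inv_pos.2 (hr0 x)), inv_mul_cancel₀ (hr0 x).ne']
  refine ⟨d, _, w, hM.blockDiagonal κ, hws, fun g x => ?_, hw0, fun x y hrxy hwxy => ?_,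
    fun x v hrv hwv => ?_⟩
  · funext p
    rw [Matrix.mulVec, dotProduct, Fintype.sum_prod_type]
    simp only [hw, Matrix.blockDiagonal_apply, ite_mul, zero_mul, Finset.sum_ite_eq,
      Finset.mem_univ, if_true]
    rw [orbitIntegral_eq_inner (EG := EG) μ (hf p.2), ← leftRegular_toLp_orbitMap, hMe]
    simp only [← orbitIntegral_eq_inner]
  -- Both points are rescaled to the compact level r = 1, which leaves w unchanged. As r x = r y,
  -- the two ratios agree and can be undone.
  · have hx := hVs _ (hmem x) _ (hmem y)
    have := hx ((hmem x).trans (hmem y).symm) fun a u hu => by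
      rw [orbitIntegral_eq_inner (EG := EG) μ (hf a), orbitIntegral_eq_inner (EG := EG) μ (hf a),
        ← sub_eq_zero, ← inner_sub_right]
      refine hspan _ (fun i => ?_) u hu
      rw [inner_sub_right, ← orbitIntegral_eq_inner, ← orbitIntegral_eq_inner, sub_eq_zero]
      have h1 := hw0 _ (inv_pos.2 (hr0 x)) x
      have h2 := hw0 _ (inv_pos.2 (hr0 y)) y
      exact congrFun ((h1.trans hwxy).trans h2.symm) (i, a)
    rw [hrxy] at this
    have h3 := congrArg (C.dil (r y)⁻¹⁻¹) this
    rwa [C.dil_inv_dil (inv_pos.2 (hr0 y)), C.dil_inv_dil (inv_pos.2 (hr0 y))] at h3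
  -- The vector is carried to the level r = 1 by a homothety, where it must vanish; the differential
  -- of the homothety is invertible.
  · set t := (r x)⁻¹ with ht
    have ht0 : 0 < t := inv_pos.2 (hr0 x)
    have hdil := (C.contMDiff_dil ht0).mdifferentiable (by simp) x
    have hlin : ∀ {F : S → ℝ} {k : ℝ}, ContMDiff IS 𝓘(ℝ, ℝ) ∞ F →
        (∀ y, F (C.dil t y) = k * F y) → differential IS F x v = 0 →
        differential IS F (C.dil t x) (mfderiv IS IS (C.dil t) x v) = 0 := by
      intro F k hF hk h0
      rw [← differential_comp_self_map (hF.mdifferentiable (by simp) _) hdil]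
      simp only [hk]
      have := differential_clm_comp (hF.mdifferentiable (by simp) x)
        (ContinuousLinearMap.mul ℝ ℝ k) v
      rw [h0, map_zero] at this
      exact this
    have h0 : (mfderiv IS IS (C.dil t) x v : ES) = 0 := by
      refine hVi _ (hmem x) _ (hlin hr (hr1 t ht0) hrv) fun a u hu => ?_
      refine (differential_orbitIntegral_eq_inner (EG := EG) μ (hf a) _ _ u).trans ?_
      refine hspan _ (fun i => ?_) u hu
      refine (differential_orbitIntegral_eq_inner (EG := EG) μ (hf a) _ _ (e i)).symm.trans ?_
      exact hlin (k := 1) (hws (i, a)) (fun y => (congrFun (hw0 t ht0 y) (i, a)).trans (one_mul _).symm) (hwv (i, a))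
    have hid : C.dil t⁻¹ ∘ C.dil t = id := funext fun y => C.dil_inv_dil ht0 y
    have hc := mfderiv_comp x ((C.contMDiff_dil (inv_pos.2 ht0)).mdifferentiable (by simp) _) hdil
    rw [hid, mfderiv_id] at hc
    have hcv : v = (mfderiv IS IS (C.dil t⁻¹) (C.dil t x) : ES →L[ℝ] ES)
      (mfderiv IS IS (C.dil t) x v : ES) := congrArg (fun L : ES →L[ℝ] ES => L v) hc
    rw [hcv, h0]
    exact map_zero _

end EquivariantImmersion

/-! ### Coefficients of a horizontal form -/

namespace SmoothCone

variable
    {ES : Type*} [NormedAddCommGroup ES] [NormedSpace ℝ ES] [FiniteDimensional ℝ ES]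
    {HS : Type*} [TopologicalSpace HS] {IS : ModelWithCorners ℝ ES HS}
    {EX : Type*} [NormedAddCommGroup EX] [NormedSpace ℝ EX]
    {HX : Type*} [TopologicalSpace HX] {IX : ModelWithCorners ℝ EX HX}
    {S : Type*} [TopologicalSpace S] [ChartedSpace HS S] [IsManifold IS ∞ S]
    {X : Type*} [TopologicalSpace X] [ChartedSpace HX X]
    (C : SmoothCone IS IX S X) {ι : Type*} [Fintype ι] {r : S → ℝ} {w : S → ι → ℝ}
    {lam : SmoothOneForm IS S}

/-- A horizontal form is a combination of the differentials of functions of degree zero which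
together with a positive function of degree one form an immersion. -/
theorem exists_smooth_coefficients [T2Space S] [SigmaCompactSpace S]
    (hr : ContMDiff IS 𝓘(ℝ, ℝ) ∞ r) (hr0 : ∀ x, 0 < r x)
    (hr1 : ∀ t, 0 < t → ∀ x, r (C.dil t x) = t * r x)
    (hw : ∀ i, ContMDiff IS 𝓘(ℝ, ℝ) ∞ fun x => w x i)
    (hw0 : ∀ t, 0 < t → ∀ x, w (C.dil t x) = w x)
    (himm : ∀ (x : S) (v : ES), differential IS r x v = 0 →
      (∀ i, differential IS (fun y => w y i) x v = 0) → v = 0)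
    (hhor : C.IsHorizontal lam) :
    ∃ b : S → ι → ℝ, (∀ i, ContMDiff IS 𝓘(ℝ, ℝ) ∞ fun x => b x i) ∧
      ∀ (x : S) (v : ES), lam x v = ∑ i, b x i * differential IS (fun y => w y i) x v := by
  classical
  -- The condition on L is affine at each point, so local solutions glue by a partition of unity.
  obtain ⟨L, hL⟩ := exists_contMDiffMap_forall_mem_convex_of_local IS (n := ⊤)
    (t := fun x : S => {L : (ℝ × (ι → ℝ)) →L[ℝ] ℝ |
      ∀ v : ES, L (differential IS (fun x => (r x, w x)) x v) = lam x v})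
    (by
      intro x L hL L' hL' a a' _ _ haa v
      rw [add_apply, smul_apply,
        smul_apply, hL v, hL' v, ← add_smul, haa, one_smul])
    (by
      intro x
      obtain ⟨U, hU, -, -, h⟩ := exists_nhds_immersion (contMDiff_prodMk_pi hr hw)
        (differential_prodMk_pi_injective hr hw (himm x))
      obtain ⟨b, hb, hbl⟩ := h lam
      exact ⟨U, hU, b, hb, hbl⟩)
  have hdecomp : ∀ (A : (ℝ × (ι → ℝ)) →L[ℝ] ℝ) (a : ℝ) (u : ι → ℝ),
      A (a, u) = a * A (1, 0) + ∑ i, A (0, Pi.single i 1) * u i := by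
    intro A a u
    have h1 : (a, u) = a • ((1 : ℝ), (0 : ι → ℝ)) + ∑ i, u i • ((0 : ℝ), Pi.single i (1 : ℝ)) := by
      refine Prod.ext ?_ ?_
      · simp [Prod.fst_sum]
      · simp only [Prod.snd_add, Prod.smul_snd, smul_zero, zero_add, Prod.snd_sum]
        exact pi_eq_sum_univ' u
    rw [h1, map_add, map_smul, map_sum, smul_eq_mul]
    simp only [map_smul, smul_eq_mul, mul_comm]
  refine ⟨fun x i => L x (0, Pi.single i 1), fun i => ?_, fun x v => ?_⟩
  · exact (ContinuousLinearMap.apply ℝ ℝ ((0 : ℝ), (Pi.single i 1 : ι → ℝ))).contMDiff.comp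
      L.contMDiff
  -- The coefficient of dr vanishes: on the radial field λ and dw are zero, while dr takes the value
  -- r > 0.
  · have hz : L x (1, 0) = 0 := by
      have key : ∀ u : ES, lam x u = 0 → differential IS r x u = r x →
          (∀ i, differential IS (fun y => w y i) x u = 0) → L x (1, 0) = 0 := by
        intro u hl hru hwu
        have h1 := hL x u
        rw [differential_prodMk_pi hr hw, hdecomp, hru] at h1
        simp only [hwu, mul_zero, Finset.sum_const_zero, add_zero] at h1
        exact (mul_eq_zero.1 (h1.trans hl)).resolve_left (hr0 x).ne'
      exact key (C.radialField x) (hhor x)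
        (C.differential_radialField_of_degree_one (hr.mdifferentiable (by simp) x)
          fun t ht => hr1 t ht x)
        fun i => C.differential_radialField_of_degree_zero ((hw i).mdifferentiable (by simp) x)
          fun t ht => congrFun (hw0 t ht x) i
    rw [← hL x v, differential_prodMk_pi hr hw, hdecomp, hz, mul_zero, zero_add]

/-- The coefficients can be taken homogeneous of degree one. -/
theorem exists_homogeneous_coefficients [T2Space S] [SigmaCompactSpace S]
    (hr : ContMDiff IS 𝓘(ℝ, ℝ) ∞ r) (hr0 : ∀ x, 0 < r x)
    (hr1 : ∀ t, 0 < t → ∀ x, r (C.dil t x) = t * r x)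
    (hw : ∀ i, ContMDiff IS 𝓘(ℝ, ℝ) ∞ fun x => w x i)
    (hw0 : ∀ t, 0 < t → ∀ x, w (C.dil t x) = w x)
    (himm : ∀ (x : S) (v : ES), differential IS r x v = 0 →
      (∀ i, differential IS (fun y => w y i) x v = 0) → v = 0)
    (hhor : C.IsHorizontal lam) (hhom : C.HasRadialLieDeriv lam lam) :
    ∃ b : S → ι → ℝ, (∀ i, ContMDiff IS 𝓘(ℝ, ℝ) ∞ fun x => b x i) ∧
      (∀ t, 0 < t → ∀ x i, b (C.dil t x) i = t * b x i) ∧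
      ∀ (x : S) (v : ES), lam x v = ∑ i, b x i * differential IS (fun y => w y i) x v := by
  obtain ⟨b, hb, hbl⟩ := C.exists_smooth_coefficients hr hr0 hr1 hw hw0 himm hhor
  have hrinv : ContMDiff IS 𝓘(ℝ, ℝ) ∞ fun x => (r x)⁻¹ := hr.inv₀ fun x => (hr0 x).ne'
  -- The coefficients on the level r = 1 are extended with degree 1. At a given x the ratio is
  -- frozen at 1/r(x), and the pullback of λ by that one homothety is λ/r(x), while w is unchanged.
  refine ⟨fun x i => r x * b (C.dil (r x)⁻¹ x) i, fun i => hr.mul ((hb i).comp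
    (C.contMDiff_dil_comp hrinv fun x => inv_pos.2 (hr0 x))), fun t ht x i => ?_, fun x v => ?_⟩
  · have : C.dil (r (C.dil t x))⁻¹ (C.dil t x) = C.dil (r x)⁻¹ x := by
      rw [hr1 t ht, ← C.dil_mul _ _ (inv_pos.2 (mul_pos ht (hr0 x))) ht, mul_inv_rev, mul_assoc,
        inv_mul_cancel₀ ht.ne', mul_one]
    change r (C.dil t x) * b (C.dil (r (C.dil t x))⁻¹ (C.dil t x)) i = _
    rw [this, hr1 t ht, mul_assoc]
  · have ht := inv_pos.2 (hr0 x)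
    have hdil := (C.contMDiff_dil ht).mdifferentiable (by simp) x
    have h1 := C.pullbackOneForm_dil hhom ht x v
    have h2 : pullbackOneForm (C.dil (r x)⁻¹) lam x v
        = ∑ i, b (C.dil (r x)⁻¹ x) i * differential IS (fun y => w y i) x v := by
      refine (hbl _ (mfderiv IS IS (C.dil (r x)⁻¹) x v)).trans ?_
      refine Finset.sum_congr rfl fun i _ => ?_
      have h3 := differential_comp_self_map ((hw i).mdifferentiable (by simp) _) hdil v
      simp only [hw0 _ ht] at h3
      rw [h3]
    rw [h2] at h1
    simp only [mul_assoc, ← Finset.mul_sum]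
    rw [h1, mul_inv_cancel_left₀ (hr0 x).ne']

end SmoothCone

/-! ### Equivariance of the coefficients by averaging -/

section Averaging

open MeasureTheory

variable {EG : Type*} [NormedAddCommGroup EG] [NormedSpace ℝ EG]
  {G : Type*} [Group G] [TopologicalSpace G] [ChartedSpace EG G] [LieGroup 𝓘(ℝ, EG) ∞ G]
  [CompactSpace G] [SecondCountableTopology G] [MeasurableSpace G] [BorelSpace G]
  [IsTopologicalGroup G]
  (μ : Measure G) [IsProbabilityMeasure μ] [μ.IsMulLeftInvariant]
  {ES : Type*} [NormedAddCommGroup ES] [NormedSpace ℝ ES] [FiniteDimensional ℝ ES]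
  {HS : Type*} [TopologicalSpace HS] {IS : ModelWithCorners ℝ ES HS}
  {S : Type*} [TopologicalSpace S] [ChartedSpace HS S] [IsManifold IS ∞ S]
  [MulAction G S] [ContMDiffSMul 𝓘(ℝ, EG) IS ∞ G S]
  {EX : Type*} [NormedAddCommGroup EX] [NormedSpace ℝ EX]
  {HX : Type*} [TopologicalSpace HX] {IX : ModelWithCorners ℝ EX HX}
  {X : Type*} [TopologicalSpace X] [ChartedSpace HX X]
  {ι : Type*} [Fintype ι] [DecidableEq ι]

theorem integrable_of_continuous_of_compact {c : G → ℝ} (hc : Continuous c) : Integrable c μ :=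
  hc.integrable_of_hasCompactSupport (HasCompactSupport.of_compactSpace c)

include EG μ in
variable (EG) in
/-- Averaging makes the coefficients of an invariant form equivariant. -/
theorem exists_equivariant_coefficients (C : SmoothCone IS IX S X)
    (hcomm : ∀ (g : G) (t : ℝ), 0 < t → ∀ x : S, g • C.dil t x = C.dil t (g • x))
    {lam : SmoothOneForm IS S}
    (hinv : ∀ (g : G) (x : S) (v : TangentSpace IS x),
      pullbackOneForm (fun y : S => g • y) lam x v = lam x v)
    {M : G → Matrix ι ι ℝ} (hM : IsOrthogonalMatrixRep M) {w b : S → ι → ℝ}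
    (hw : ∀ i, ContMDiff IS 𝓘(ℝ, ℝ) ∞ fun x => w x i)
    (hwM : ∀ g x, w (g • x) = (M g).mulVec (w x))
    (hb : ∀ i, ContMDiff IS 𝓘(ℝ, ℝ) ∞ fun x => b x i)
    (hb1 : ∀ t, 0 < t → ∀ x i, b (C.dil t x) i = t * b x i)
    (hbl : ∀ (x : S) (v : ES), lam x v = ∑ i, b x i * differential IS (fun y => w y i) x v) :
    ∃ b' : S → ι → ℝ, (∀ i, ContMDiff IS 𝓘(ℝ, ℝ) ∞ fun x => b' x i) ∧
      (∀ t, 0 < t → ∀ x i, b' (C.dil t x) i = t * b' x i) ∧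
      (∀ g x, b' (g • x) = (M g).mulVec (b' x)) ∧
      ∀ (x : S) (v : ES), lam x v = ∑ i, b' x i * differential IS (fun y => w y i) x v := by
  have hMc : ∀ i j, Continuous fun g => M g i j := fun i j => hM.continuous.matrix_elem i j
  have hbc : ∀ j x, Continuous fun g : G => b (g⁻¹ • x) j := fun j x =>
    (contMDiff_uncurry_inv_smul EG (hb j)).continuous.comp
      (continuous_id.prodMk continuous_const)
  have hint : ∀ i j x, Integrable (fun g => M g i j * b (g⁻¹ • x) j) μ := fun i j x =>
    integrable_of_continuous_of_compact μ ((hMc i j).mul (hbc j x))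
  -- This is b'(x) = ∫ M(g) b(g⁻¹x) dg, equivariant by left invariance of the measure.
  set b' : S → ι → ℝ := fun x i =>
    ∑ j, orbitIntegral μ (fun g => M g i j) (fun y => b y j) x with hb'
  have hbi : ∀ x i, b' x i = ∫ g, ∑ j, M g i j * b (g⁻¹ • x) j ∂μ := fun x i =>
    (integral_finsetSum _ fun j _ => hint i j x).symm
  refine ⟨b', fun i => ?_, fun t ht x i => ?_, fun h x => funext fun i => ?_, fun x v => ?_⟩
  · exact contMDiff_finsetSum fun j _ =>
      contMDiff_orbitIntegral EG μ (integrable_of_continuous_of_compact μ (hMc i j)) (hb j)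
  · simp only [hb', Finset.mul_sum]
    exact Finset.sum_congr rfl fun j _ =>
      orbitIntegral_dil μ C hcomm _ ht (fun y => hb1 t ht y j) x
  · rw [hbi, ← integral_mul_left_eq_self _ h, Matrix.mulVec, dotProduct]
    simp only [hbi]
    simp only [← integral_const_mul]
    rw [← integral_finsetSum _ fun k _ =>
      (integrable_finsetSum _ fun j _ => hint k j x).const_mul _]
    refine integral_congr_ae (.of_forall fun g => ?_)
    simp only [hM.map_mul, Matrix.mul_apply, mul_inv_rev, mul_smul, inv_smul_smul,
      Finset.mul_sum, Finset.sum_mul]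
    rw [Finset.sum_comm]
    simp only [mul_assoc]
  -- For every single g the functions M(g) b(g⁻¹x) are already coefficients of λ: λ is invariant,
  -- and M(g⁻¹) is the transpose of M(g). Averaging against a probability measure preserves the
  -- identity.
  · have hg : ∀ g : G, lam x v
        = ∑ i, (∑ j, M g i j * b (g⁻¹ • x) j) * differential IS (fun y => w y i) x v := by
      intro g
      have hsm : ContMDiff IS IS ∞ fun y : S => g⁻¹ • y :=
        (contMDiff_smul (I := 𝓘(ℝ, EG)) (I' := IS)).comp (contMDiff_const.prodMk contMDiff_id)
      refine (hinv g⁻¹ x v).symm.trans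
        ((hbl _ (mfderiv IS IS (fun y : S => g⁻¹ • y) x v)).trans ?_)
      have h1 : ∀ j, differential IS (fun y => w y j) (g⁻¹ • x)
          (mfderiv IS IS (fun y : S => g⁻¹ • y) x v)
            = ∑ i, M g i j * differential IS (fun y => w y i) x v := by
        intro j
        have h2 := differential_comp_self_map ((hw j).mdifferentiable (by simp) _)
          (hsm.mdifferentiable (by simp) x) v
        refine h2.symm.trans ?_
        have h3 := differential_clm_comp ((contMDiff_pi_space.2 hw).mdifferentiable (by simp) x)
          (∑ i, M g i j • ContinuousLinearMap.proj (R := ℝ) (φ := fun _ : ι => ℝ) i) v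
        have h4 : ∀ i, differential IS w x v i = differential IS (fun y => w y i) x v := fun i =>
          (differential_clm_comp ((contMDiff_pi_space.2 hw).mdifferentiable (by simp) x)
            (ContinuousLinearMap.proj (R := ℝ) (φ := fun _ : ι => ℝ) i) v).symm
        simp only [hwM, ← hM.transpose, Matrix.mulVec, dotProduct, Matrix.transpose_apply]
        simp only [sum_apply, smul_apply,
          ContinuousLinearMap.proj_apply, smul_eq_mul] at h3
        rw [h3]
        exact Finset.sum_congr rfl fun i _ => by rw [← h4]
      simp only [h1, Finset.mul_sum, Finset.sum_mul]
      rw [Finset.sum_comm]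
      exact Finset.sum_congr rfl fun i _ => Finset.sum_congr rfl fun j _ => by ring
    have h5 : lam x v = ∫ _ : G, lam x v ∂μ := by simp
    rw [h5]
    simp only [hbi, ← integral_mul_const]
    rw [← integral_finsetSum _ fun i _ =>
      (integrable_finsetSum _ fun j _ => hint i j x).mul_const _]
    exact integral_congr_ae (.of_forall hg)

end Averaging

/-! ### Complex vectors through real and imaginary parts -/

/-- The vector of `ℂⁿ` with given real and imaginary parts. -/
noncomputable def complexVector {n : ℕ} (p q : Fin n → ℝ) : EuclideanSpace ℂ (Fin n) :=
  WithLp.toLp 2 fun k => ⟨p k, q k⟩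

theorem complexVector_apply {n : ℕ} (p q : Fin n → ℝ) (k : Fin n) :
    complexVector p q k = ⟨p k, q k⟩ := rfl

theorem real_smul_complexVector {n : ℕ} (c : ℝ) (p q : Fin n → ℝ) :
    c • complexVector p q = complexVector (c • p) (c • q) := by
  ext k
  rw [PiLp.smul_apply, complexVector_apply, complexVector_apply]
  apply Complex.ext <;> simp

theorem toEuclideanLin_complexifyRep {G : Type*} [Group G] {n : ℕ}
    (rep : G →* Matrix.orthogonalGroup (Fin n) ℝ) (g : G) (p q : Fin n → ℝ) :
    Matrix.toEuclideanLin (complexifyRep rep g : Matrix (Fin n) (Fin n) ℂ) (complexVector p q)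
      = complexVector ((rep g : Matrix (Fin n) (Fin n) ℝ).mulVec p)
        ((rep g : Matrix (Fin n) (Fin n) ℝ).mulVec q) := by
  ext k
  change ∑ j, ((rep g : Matrix (Fin n) (Fin n) ℝ) k j : ℂ) * (⟨p j, q j⟩ : ℂ) = ⟨_, _⟩
  apply Complex.ext
  · rw [Complex.re_sum]
    simp [Matrix.mulVec, dotProduct]
  · rw [Complex.im_sum]
    simp [Matrix.mulVec, dotProduct]

section ComplexVector

variable {ES : Type*} [NormedAddCommGroup ES] [NormedSpace ℝ ES]
  {HS : Type*} [TopologicalSpace HS] {IS : ModelWithCorners ℝ ES HS}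
  {S : Type*} [TopologicalSpace S] [ChartedSpace HS S]
  {n : ℕ} {p q : S → Fin n → ℝ}

theorem differential_mul {f g : S → ℝ} {x : S} (hf : MDifferentiableAt IS 𝓘(ℝ, ℝ) f x)
    (hg : MDifferentiableAt IS 𝓘(ℝ, ℝ) g x) (v : ES) :
    differential IS (fun y => f y * g y) x v
      = f x * differential IS g x v + g x * differential IS f x v :=
  congrArg (fun L : ES →L[ℝ] ℝ => L v) (hf.hasMFDerivAt.mul hg.hasMFDerivAt).mfderiv

theorem contMDiff_complexVector (hp : ∀ k, ContMDiff IS 𝓘(ℝ, ℝ) ∞ fun x => p x k)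
    (hq : ∀ k, ContMDiff IS 𝓘(ℝ, ℝ) ∞ fun x => q x k) :
    ContMDiff IS 𝓘(ℝ, EuclideanSpace ℂ (Fin n)) ∞ fun x => complexVector (p x) (q x) :=
  (PiLp.continuousLinearEquiv 2 ℝ (fun _ : Fin n => ℂ)).symm.toContinuousLinearMap.contMDiff.comp
    (contMDiff_pi_space.2 fun k => Complex.equivRealProdCLM.symm.toContinuousLinearMap.contMDiff.comp
      ((hp k).prodMk_space (hq k)))

theorem differential_complexVector (hp : ∀ k, ContMDiff IS 𝓘(ℝ, ℝ) ∞ fun x => p x k)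
    (hq : ∀ k, ContMDiff IS 𝓘(ℝ, ℝ) ∞ fun x => q x k) (x : S) (v : ES) :
    differential IS (fun x => complexVector (p x) (q x)) x v
      = complexVector (fun k => differential IS (fun y => p y k) x v)
        (fun k => differential IS (fun y => q y k) x v) := by
  have h := (contMDiff_complexVector hp hq).mdifferentiable (by simp) x
  let P (k : Fin n) : EuclideanSpace ℂ (Fin n) →L[ℝ] ℂ :=
    (EuclideanSpace.proj (𝕜 := ℂ) k).restrictScalars ℝ
  ext k
  apply Complex.ext
  · exact (differential_clm_comp h (Complex.reCLM.comp (P k)) v).symm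
  · exact (differential_clm_comp h (Complex.imCLM.comp (P k)) v).symm

theorem imConjDot_complexVector (hp : ∀ k, ContMDiff IS 𝓘(ℝ, ℝ) ∞ fun x => p x k)
    (hq : ∀ k, ContMDiff IS 𝓘(ℝ, ℝ) ∞ fun x => q x k) (x : S) (v : ES) :
    imConjDot IS (fun x => complexVector (p x) (q x)) x v
      = ∑ k, (p x k * differential IS (fun y => q y k) x v
        - q x k * differential IS (fun y => p y k) x v) := by
  have h := differential_complexVector hp hq x v
  change (∑ k, starRingEnd ℂ (complexVector (p x) (q x) k)
    * (differential IS (fun x => complexVector (p x) (q x)) x v) k).im = _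
  rw [h, Complex.im_sum]
  refine Finset.sum_congr rfl fun k _ => ?_
  simp only [complexVector_apply, Complex.mul_im, Complex.conj_re, Complex.conj_im]
  ring

end ComplexVector

/-! ### The embedding into the complexified representation -/

namespace SmoothCone

variable
    {ES : Type*} [NormedAddCommGroup ES] [NormedSpace ℝ ES]
    {HS : Type*} [TopologicalSpace HS] {IS : ModelWithCorners ℝ ES HS}
    {EX : Type*} [NormedAddCommGroup EX] [NormedSpace ℝ EX]
    {HX : Type*} [TopologicalSpace HX] {IX : ModelWithCorners ℝ EX HX}
    {S : Type*} [TopologicalSpace S] [ChartedSpace HS S]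
    {X : Type*} [TopologicalSpace X] [ChartedSpace HX X]
    (C : SmoothCone IS IX S X) {r : S → ℝ}

/-- If the level sets of `r` are compact, a map of degree zero which is injective together with `r`
detects convergence together with `r`. -/
theorem tendsto_nhds_of_degree_zero {W : Type*} [TopologicalSpace W] [T2Space W]
    (hr0 : ∀ x, 0 < r x) (hr1 : ∀ t, 0 < t → ∀ x, r (C.dil t x) = t * r x)
    (hK : IsCompact {x | r x = 1}) {w : S → W} (hw : Continuous w)
    (hw0 : ∀ t, 0 < t → ∀ x, w (C.dil t x) = w x)
    (hsep : ∀ x y, r x = r y → w x = w y → x = y) {l : Filter S} {x : S}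
    (hlr : Filter.Tendsto r l (𝓝 (r x))) (hlw : Filter.Tendsto w l (𝓝 (w x))) : l ≤ 𝓝 x := by
  have hmem : ∀ y, r (C.dil (r y)⁻¹ y) = 1 := fun y => by
    rw [hr1 _ (inv_pos.2 (hr0 y)), inv_mul_cancel₀ (hr0 y).ne']
  have hback : ∀ y, C.dil (r y) (C.dil (r y)⁻¹ y) = y := fun y => by
    rw [← C.dil_mul _ _ (hr0 y) (inv_pos.2 (hr0 y)), mul_inv_cancel₀ (hr0 y).ne', C.dil_one]
  let N : S → {x | r x = 1} := fun y => ⟨C.dil (r y)⁻¹ y, hmem y⟩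
  have := isCompact_iff_compactSpace.1 hK
  -- On the compact level r = 1 the map w is continuous and injective, hence a closed embedding.
  -- Convergence of w thus gives convergence of the normalized points, which are then dilated back
  -- by r.
  have hemb : IsClosedEmbedding fun k : {x | r x = 1} => w k :=
    (hw.comp continuous_subtype_val).isClosedEmbedding fun a b hab =>
      Subtype.ext (hsep _ _ (a.2.trans b.2.symm) hab)
  have hwN : ∀ y, w (N y) = w y := fun y => hw0 _ (inv_pos.2 (hr0 y)) y
  have hN : Filter.Tendsto N l (𝓝 (N x)) := by
    rw [hemb.isInducing.tendsto_nhds_iff]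
    change Filter.Tendsto (fun y => w (N y)) l (𝓝 (w (N x)))
    simpa only [hwN] using hlw
  have hd := (C.contMDiffAt_dil (hr0 x) (N x : S)).continuousAt.tendsto.comp
    (hlr.prodMk_nhds ((continuous_subtype_val.tendsto _).comp hN))
  have h1 : ((fun q : ℝ × S => C.dil q.1 q.2) ∘ fun y => (r y, (Subtype.val ∘ N) y)) = id :=
    funext fun y => hback y
  have h2 : C.dil (r x) (N x : S) = x := hback x
  rw [h1] at hd
  change Filter.Tendsto id l (𝓝 (C.dil (r x) (N x : S))) at hd
  rw [h2] at hd
  exact hd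

/-- The embedding into a complexified representation built from equivariant functions `w` and `β` of
degree zero with `lam = r β · dw`. -/
theorem exists_complex_embedding {G : Type*} [Group G] [TopologicalSpace G] [MulAction G S]
    [IsManifold IS ∞ S] {ι : Type*} [Fintype ι] [DecidableEq ι] {w β : S → ι → ℝ}
    {M : G → Matrix ι ι ℝ} (hM : IsOrthogonalMatrixRep M)
    (hr : ContMDiff IS 𝓘(ℝ, ℝ) ∞ r) (hr0 : ∀ x, 0 < r x)
    (hr1 : ∀ t, 0 < t → ∀ x, r (C.dil t x) = t * r x) (hK : IsCompact {x | r x = 1})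
    (hrG : ∀ (g : G) x, r (g • x) = r x)
    (hw : ∀ i, ContMDiff IS 𝓘(ℝ, ℝ) ∞ fun x => w x i)
    (hw0 : ∀ t, 0 < t → ∀ x, w (C.dil t x) = w x) (hwM : ∀ g x, w (g • x) = (M g).mulVec (w x))
    (hsep : ∀ x y, r x = r y → w x = w y → x = y)
    (himm : ∀ (x : S) (v : ES), differential IS r x v = 0 →
      (∀ i, differential IS (fun y => w y i) x v = 0) → v = 0)
    (hβ : ∀ i, ContMDiff IS 𝓘(ℝ, ℝ) ∞ fun x => β x i)
    (hβ0 : ∀ t, 0 < t → ∀ x, β (C.dil t x) = β x) (hβM : ∀ g x, β (g • x) = (M g).mulVec (β x))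
    {lam : SmoothOneForm IS S}
    (hlam : ∀ (x : S) (v : ES),
      lam x v = r x * ∑ i, β x i * differential IS (fun y => w y i) x v) :
    ∃ (n : ℕ) (rep : G →* Matrix.orthogonalGroup (Fin n) ℝ) (z : S → EuclideanSpace ℂ (Fin n)),
      Continuous rep ∧ IsSmoothEmbeddingInto IS z ∧
      (∀ (g : G) (x : S),
        z (g • x) = Matrix.toEuclideanLin (complexifyRep rep g : Matrix (Fin n) (Fin n) ℂ) (z x)) ∧
      (∀ (t : ℝ), 0 < t → ∀ x : S, z (C.dil t x) = Real.sqrt t • z x) ∧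
      ∀ (x : S) (v : TangentSpace IS x), lam x v = imConjDot IS z x v := by
  let e := Fintype.equivFin (ι ⊕ Unit)
  have hM' := (hM.fromBlocks_one Unit).reindex e
  set s : S → ℝ := fun x => √(r x) with hs
  have hs0 : ∀ x, 0 < s x := fun x => Real.sqrt_pos.2 (hr0 x)
  have hss : ∀ x, s x * s x = r x := fun x => Real.mul_self_sqrt (hr0 x).le
  have hsm : ContMDiff IS 𝓘(ℝ, ℝ) ∞ s := fun x =>
    (Real.contDiffAt_sqrt (hr0 x).ne').contMDiffAt.comp x (hr x)
  let a : ℝ := (√2)⁻¹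
  have haa : a * a = 1 / 2 := by
    rw [← mul_inv, Real.mul_self_sqrt (by norm_num), one_div]
  have ha : a ≠ 0 := by positivity
  -- The constant 1 makes √r a coordinate of z, and paired with β·w/2 it adds ½ d(β·w) to the ½(β·dw
  -- − w·dβ) of the first block; a² = 1/2 supplies that factor.
  let u : S → ι ⊕ Unit → ℝ := fun x => Sum.elim (fun i => a * β x i) fun _ => 1
  let v : S → ι ⊕ Unit → ℝ := fun x => Sum.elim (fun i => a * w x i) fun _ => (β x ⬝ᵥ w x) / 2
  have hdot : ContMDiff IS 𝓘(ℝ, ℝ) ∞ fun x => (β x ⬝ᵥ w x) / 2 := by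
    simp only [div_eq_mul_inv]
    exact (contMDiff_finsetSum fun i _ => (hβ i).mul (hw i)).mul contMDiff_const
  have hu : ∀ j, ContMDiff IS 𝓘(ℝ, ℝ) ∞ fun x => u x j := by
    rintro (i | i)
    · exact contMDiff_const.mul (hβ i)
    · exact contMDiff_const
  have hv : ∀ j, ContMDiff IS 𝓘(ℝ, ℝ) ∞ fun x => v x j := by
    rintro (i | i)
    · exact contMDiff_const.mul (hw i)
    · exact hdot
  let p : S → Fin (Fintype.card (ι ⊕ Unit)) → ℝ := fun x k => s x * u x (e.symm k)
  let q : S → Fin (Fintype.card (ι ⊕ Unit)) → ℝ := fun x k => s x * v x (e.symm k)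
  have hp : ∀ k, ContMDiff IS 𝓘(ℝ, ℝ) ∞ fun x => p x k := fun k => hsm.mul (hu _)
  have hq : ∀ k, ContMDiff IS 𝓘(ℝ, ℝ) ∞ fun x => q x k := fun k => hsm.mul (hv _)
  have hpl : ∀ x, p x (e (Sum.inr ())) = s x := fun x => by simp [p, u]
  have hqw : ∀ x i, q x (e (Sum.inl i)) = s x * (a * w x i) := fun x i => by simp [q, v]
  have hz : ContMDiff IS 𝓘(ℝ, EuclideanSpace ℂ (Fin (Fintype.card (ι ⊕ Unit)))) ∞
      fun x => complexVector (p x) (q x) := contMDiff_complexVector hp hq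
  have hrep : ∀ g x, p (g • x) = (hM'.toMonoidHom g : Matrix _ _ ℝ).mulVec (p x) ∧
      q (g • x) = (hM'.toMonoidHom g : Matrix _ _ ℝ).mulVec (q x) := by
    intro g x
    have hgs : s (g • x) = s x := by simp only [hs, hrG]
    have hbl : ∀ y : ι ⊕ Unit → ℝ, ((Matrix.fromBlocks (M g) 0 0 (1 : Matrix Unit Unit ℝ)).submatrix
        e.symm e.symm).mulVec (fun k => s x * y (e.symm k))
        = fun k => s x * (Matrix.fromBlocks (M g) 0 0 (1 : Matrix Unit Unit ℝ)).mulVec y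
          (e.symm k) := by
      intro y
      rw [Matrix.submatrix_mulVec_equiv]
      have : (fun k => s x * y (e.symm k)) ∘ e.symm.symm = s x • y := by
        funext j
        simp
      rw [this, Matrix.mulVec_smul]
      rfl
    have hfb : ∀ (y : ι → ℝ) (c : ℝ),
        (Matrix.fromBlocks (M g) 0 0 (1 : Matrix Unit Unit ℝ)).mulVec
          (Sum.elim (fun i => a * y i) fun _ => c)
        = Sum.elim (fun i => a * (M g).mulVec y i) fun _ => c := by
      intro y c
      rw [Matrix.fromBlocks_mulVec]
      have h1 : (Sum.elim (fun i => a * y i) fun _ : Unit => c) ∘ Sum.inl = a • y := rfl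
      have h2 : (Sum.elim (fun i => a * y i) fun _ : Unit => c) ∘ Sum.inr = fun _ => c := rfl
      rw [h1, h2, Matrix.mulVec_smul, Matrix.zero_mulVec, Matrix.zero_mulVec, Matrix.one_mulVec,
        add_zero, zero_add]
      rfl
    constructor
    · refine Eq.trans ?_ (hbl (u x)).symm
      funext k
      simp only [p, u, hgs, hβM, hfb]
    -- The last coordinate β·w/2 is invariant because M is orthogonal, matching the trivial summand.
    · refine Eq.trans ?_ (hbl (v x)).symm
      funext k
      simp only [q, v, hgs, hβM, hwM, hM.dotProduct_mulVec, hfb]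
  refine ⟨_, hM'.toMonoidHom, fun x => complexVector (p x) (q x), hM'.continuous_toMonoidHom,
    ⟨hz, ?_, fun x => ?_⟩, fun g x => ?_, fun t ht x => ?_, ?_⟩
  · have hre : ∀ k, Continuous fun ζ : EuclideanSpace ℂ (Fin (Fintype.card (ι ⊕ Unit))) =>
        (ζ k).re := fun k => Complex.continuous_re.comp (EuclideanSpace.proj k).continuous
    have him : ∀ k, Continuous fun ζ : EuclideanSpace ℂ (Fin (Fintype.card (ι ⊕ Unit))) =>
        (ζ k).im := fun k => Complex.continuous_im.comp (EuclideanSpace.proj k).continuous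
    -- w is a continuous function of z because its denominator √r is itself a coordinate of z.
    -- Together with r = (√r)² this gives both injectivity and the inducing property.
    have hrec : ∀ x i, w x i = q x (e (Sum.inl i)) / (p x (e (Sum.inr ())) * a) := by
      intro x i
      have := (hs0 x).ne'
      rw [hpl, hqw]
      field_simp
    refine ⟨isInducing_iff_nhds.2 fun x => le_antisymm ?_ ?_, fun x y hxy => ?_⟩
    · exact (hz.continuous.tendsto x).le_comap
    · set l := Filter.comap (fun x => complexVector (p x) (q x))
        (𝓝 (complexVector (p x) (q x))) with hl
      have hlz : Filter.Tendsto (fun x => complexVector (p x) (q x)) l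
        (𝓝 (complexVector (p x) (q x))) := Filter.tendsto_comap
      have hlp : ∀ k, Filter.Tendsto (fun y => p y k) l (𝓝 (p x k)) := fun k =>
        ((hre k).tendsto _).comp hlz
      have hlq : ∀ k, Filter.Tendsto (fun y => q y k) l (𝓝 (q x k)) := fun k =>
        ((him k).tendsto _).comp hlz
      have hls : Filter.Tendsto s l (𝓝 (s x)) := by
        simpa only [hpl] using hlp (e (Sum.inr ()))
      refine C.tendsto_nhds_of_degree_zero hr0 hr1 hK
        (continuous_pi fun i => (hw i).continuous) hw0 hsep ?_ (tendsto_pi_nhds.2 fun i => ?_)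
      · simpa only [hss] using hls.mul hls
      · simp only [hrec]
        refine (hlq _).div ((hlp _).mul_const a) ?_
        rw [hpl]
        exact mul_ne_zero (hs0 x).ne' ha
    · have hp' : ∀ k, p x k = p y k := fun k =>
        congrArg (fun ζ : EuclideanSpace ℂ _ => (ζ k).re) hxy
      have hq' : ∀ k, q x k = q y k := fun k =>
        congrArg (fun ζ : EuclideanSpace ℂ _ => (ζ k).im) hxy
      have hsxy : s x = s y := by rw [← hpl, ← hpl, hp']
      refine hsep x y (by rw [← hss, ← hss, hsxy]) (funext fun i => ?_)
      rw [hrec, hrec, hp', hq']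
  -- The real part of the last coordinate gives d√r = 0, hence dr = 0; the imaginary parts √r w/√2
  -- then give dw = 0.
  · refine (injective_iff_map_eq_zero (differential IS (fun x => complexVector (p x) (q x)) x)).2
      fun y hy => ?_
    rw [differential_complexVector hp hq] at hy
    have hp' : ∀ k, differential IS (fun y => p y k) x y = 0 := fun k =>
      congrArg (fun ζ : EuclideanSpace ℂ _ => (ζ k).re) hy
    have hq' : ∀ k, differential IS (fun y => q y k) x y = 0 := fun k =>
      congrArg (fun ζ : EuclideanSpace ℂ _ => (ζ k).im) hy
    have hsx := hsm.mdifferentiable (by simp) x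
    have hds : differential IS s x y = 0 := by
      simpa only [hpl] using hp' (e (Sum.inr ()))
    refine himm x y ?_ fun i => ?_
    · have h := differential_mul hsx hsx y
      simpa only [hss, hds, mul_zero, add_zero] using h
    · have h := hq' (e (Sum.inl i))
      simp only [hqw] at h
      have hwi := (hw i).mdifferentiable (by simp) x
      have hawi : MDifferentiableAt IS 𝓘(ℝ, ℝ) (fun y => a * w y i) x :=
        (contMDiff_const.mul (hw i)).mdifferentiable (by simp) x
      rw [differential_mul hsx hawi, hds, mul_zero, add_zero] at h
      have h1 := (differential_clm_comp hwi (ContinuousLinearMap.mul ℝ ℝ a) y).symm.trans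
        ((mul_eq_zero.1 h).resolve_left (hs0 x).ne')
      exact (mul_eq_zero.1 h1).resolve_left ha
  · rw [toEuclideanLin_complexifyRep, ← (hrep g x).1, ← (hrep g x).2]
  · have hts : s (C.dil t x) = √t * s x := by
      simp only [hs, hr1 t ht, Real.sqrt_mul ht.le]
    refine Eq.trans ?_ (real_smul_complexVector _ _ _).symm
    change complexVector (p _) (q _) = _
    congr 1
    · funext k
      simp only [p, u, hts, hβ0 t ht, Pi.smul_apply, smul_eq_mul, mul_assoc]
    · funext k
      simp only [q, v, hts, hβ0 t ht, hw0 t ht, Pi.smul_apply, smul_eq_mul, mul_assoc]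
  · suffices h : ∀ (x : S) (y : ES),
        lam x y = imConjDot IS (fun x => complexVector (p x) (q x)) x y from h
    intro x y
    have hsx := hsm.mdifferentiable (by simp) x
    have hwi := fun i => (hw i).mdifferentiable (by simp) x
    have hβi := fun i => (hβ i).mdifferentiable (by simp) x
    have hcmul : ∀ {f : S → ℝ}, MDifferentiableAt IS 𝓘(ℝ, ℝ) f x → ∀ c : ℝ,
        differential IS (fun y => c * f y) x y = c * differential IS f x y := fun hf c =>
      differential_clm_comp hf (ContinuousLinearMap.mul ℝ ℝ c) y
    -- In p dq − q dp the terms containing ds cancel, leaving s² = r as a factor.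
    have hterm : ∀ k, p x k * differential IS (fun y => q y k) x y
        - q x k * differential IS (fun y => p y k) x y
        = r x * (u x (e.symm k) * differential IS (fun y => v y (e.symm k)) x y
          - v x (e.symm k) * differential IS (fun y => u y (e.symm k)) x y) := by
      intro k
      have h1 : differential IS (fun y => q y k) x y = _ :=
        differential_mul hsx ((hv (e.symm k)).mdifferentiable (by simp) x) y
      have h2 : differential IS (fun y => p y k) x y = _ :=
        differential_mul hsx ((hu (e.symm k)).mdifferentiable (by simp) x) y
      rw [h1, h2, ← hss]
      simp only [p, q]
      ring
    have hdotd : differential IS (fun y => (β y ⬝ᵥ w y) / 2) x y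
        = ∑ i, (β x i * differential IS (fun y => w y i) x y
          + w x i * differential IS (fun y => β y i) x y) / 2 := by
      have h1 : ∀ x, (β x ⬝ᵥ w x) / 2
          = (∑ i, (1 / 2 : ℝ) • ContinuousLinearMap.proj (R := ℝ) (φ := fun _ : ι => ℝ) i)
            (fun i => β x i * w x i) := by
        intro x
        simp [dotProduct, Finset.mul_sum, div_eq_inv_mul]
      have hm : MDifferentiableAt IS 𝓘(ℝ, ι → ℝ) (fun x i => β x i * w x i) x :=
        (contMDiff_pi_space.2 fun i => (hβ i).mul (hw i)).mdifferentiable (by simp) x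
      simp only [h1]
      rw [differential_clm_comp hm]
      simp only [sum_apply, smul_apply, ContinuousLinearMap.proj_apply, smul_eq_mul]
      refine Finset.sum_congr rfl fun i _ => ?_
      rw [← differential_mul (hβi i) (hwi i)]
      have h2 := (differential_clm_comp hm
        (ContinuousLinearMap.proj (R := ℝ) (φ := fun _ : ι => ℝ) i) y)
      rw [ContinuousLinearMap.proj_apply] at h2
      rw [← h2]
      simp only [ContinuousLinearMap.proj_apply]
      ring
    refine (hlam x y).trans (Eq.trans ?_ (imConjDot_complexVector hp hq x y).symm)
    rw [Finset.sum_congr rfl fun k _ => hterm k, ← Finset.mul_sum,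
      Equiv.sum_comp e.symm fun j => u x j * differential IS (fun y => v y j) x y
          - v x j * differential IS (fun y => u y j) x y, Fintype.sum_sum_type]
    congr 1
    simp only [u, v, Sum.elim_inl, Sum.elim_inr, hcmul (hwi _), hcmul (hβi _), Finset.univ_unique,
      Finset.sum_singleton, differential_const, mul_zero, sub_zero, one_mul]
    rw [hdotd, ← Finset.sum_add_distrib]
    refine Finset.sum_congr rfl fun i _ => ?_
    linear_combination (w x i * differential IS (fun y => β y i) x y
      - β x i * differential IS (fun y => w y i) x y) * haa

end SmoothCone

/-! ### Averaging the radius -/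

section InvariantRadius

open MeasureTheory

variable {EG : Type*} [NormedAddCommGroup EG] [NormedSpace ℝ EG]
  {G : Type*} [Group G] [TopologicalSpace G] [ChartedSpace EG G] [LieGroup 𝓘(ℝ, EG) ∞ G]
  [CompactSpace G] [SecondCountableTopology G] [MeasurableSpace G] [BorelSpace G]
  [IsTopologicalGroup G]
  (μ : Measure G) [IsProbabilityMeasure μ] [μ.IsMulLeftInvariant] [μ.IsOpenPosMeasure]
  {ES : Type*} [NormedAddCommGroup ES] [NormedSpace ℝ ES] [FiniteDimensional ℝ ES]
  {HS : Type*} [TopologicalSpace HS] {IS : ModelWithCorners ℝ ES HS}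
  {S : Type*} [TopologicalSpace S] [ChartedSpace HS S] [IsManifold IS ∞ S]
  [MulAction G S] [ContMDiffSMul 𝓘(ℝ, EG) IS ∞ G S]

theorem orbitIntegral_one_smul (f : S → ℝ) (h : G) (x : S) :
    orbitIntegral μ (fun _ => 1) f (h • x) = orbitIntegral μ (fun _ => 1) f x := by
  rw [orbitIntegral, orbitIntegral,
    ← integral_mul_left_eq_self (fun g => (1 : ℝ) • f (g⁻¹ • h • x)) h]
  simp only [mul_inv_rev, mul_smul, inv_smul_smul]

include EG in
variable (EG) in
theorem orbitIntegral_one_pos {f : S → ℝ} (hf : ContMDiff IS 𝓘(ℝ, ℝ) ∞ f) (hpos : ∀ x, 0 < f x)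
    (x : S) : 0 < orbitIntegral μ (fun _ : G => 1) f x := by
  have hc : Continuous fun g : G => f (g⁻¹ • x) := (orbitMap EG hf x).continuous
  simp only [orbitIntegral, one_smul]
  exact hc.integral_pos_of_hasCompactSupport_nonneg_nonzero
    (HasCompactSupport.of_compactSpace _) (fun g => (hpos _).le) (hpos ((1 : G)⁻¹ • x)).ne'

end InvariantRadius

/-! ### Degree zero functions from an embedding of the base -/

namespace SmoothCone

variable
    {ES : Type*} [NormedAddCommGroup ES] [NormedSpace ℝ ES]
    {HS : Type*} [TopologicalSpace HS] {IS : ModelWithCorners ℝ ES HS}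
    {EX : Type*} [NormedAddCommGroup EX] [NormedSpace ℝ EX] [FiniteDimensional ℝ EX]
    {HX : Type*} [TopologicalSpace HX] {IX : ModelWithCorners ℝ EX HX}
    {S : Type*} [TopologicalSpace S] [ChartedSpace HS S] [IsManifold IS ∞ S]
    {X : Type*} [TopologicalSpace X] [ChartedSpace HX X] [IsManifold IX ∞ X] [T2Space X]
    [CompactSpace X] (C : SmoothCone IS IX S X)

/-- Functions of degree zero which together with any function of degree one form an injective
immersion. -/
theorem exists_degree_zero_injective_immersion {r : S → ℝ} (hr : ContMDiff IS 𝓘(ℝ, ℝ) ∞ r)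
    (hr0 : ∀ x, 0 < r x) (hr1 : ∀ t, 0 < t → ∀ x, r (C.dil t x) = t * r x) :
    ∃ (N : ℕ) (f : Fin N → S → ℝ), (∀ a, ContMDiff IS 𝓘(ℝ, ℝ) ∞ (f a)) ∧
      (∀ a, ∀ t, 0 < t → ∀ x, f a (C.dil t x) = f a x) ∧
      (∀ x y, r x = r y → (∀ a, f a x = f a y) → x = y) ∧
      ∀ (x : S) (v : ES), differential IS r x v = 0 →
        (∀ a, differential IS (f a) x v = 0) → v = 0 := by
  -- The functions are the coordinates of a Euclidean embedding of the base composed with the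
  -- projection. They determine a point or a tangent vector up to the fibre direction, which r
  -- detects.
  obtain ⟨N, e, he, hemb, hinj⟩ := exists_embedding_euclidean_of_compact (I := IX) (M := X)
  have hep : ContMDiff IS 𝓘(ℝ, EuclideanSpace ℝ (Fin N)) ∞ fun x => e (C.proj x) :=
    he.comp C.contMDiff_proj
  let P (a : Fin N) : EuclideanSpace ℝ (Fin N) →L[ℝ] ℝ := EuclideanSpace.proj a
  refine ⟨N, fun a x => P a (e (C.proj x)), fun a => (P a).contMDiff.comp hep,
    fun a t ht x => by simp only [C.proj_dil t ht], fun x y hxy h => ?_, fun x v hrv hv => ?_⟩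
  · have hp : C.proj x = C.proj y := hemb.injective (PiLp.ext h)
    obtain ⟨t, ht, rfl⟩ := C.exists_dil_eq_of_proj_eq hp
    rw [hr1 t ht] at hxy
    have : t = 1 := mul_right_cancel₀ (hr0 x).ne' (by rw [← hxy, one_mul])
    rw [this, C.dil_one]
  · refine C.eq_zero_of_mfderiv_proj_eq_zero hr hr0 hr1 ?_ hrv
    have h0 : differential IS (fun x => e (C.proj x)) x v = 0 := PiLp.ext fun a =>
      (differential_clm_comp (hep.mdifferentiable (by simp) x) (P a) v).symm.trans (hv a)
    have h1 : mfderiv IS 𝓘(ℝ, EuclideanSpace ℝ (Fin N)) (e ∘ C.proj) x = _ :=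
      mfderiv_comp x (he.mdifferentiable (by simp) _) (C.contMDiff_proj.mdifferentiable (by simp) x)
    have h2 : mfderiv IX 𝓘(ℝ, EuclideanSpace ℝ (Fin N)) e (C.proj x)
        (mfderiv IS IX C.proj x v) = 0 :=
      (congrArg (fun L : ES →L[ℝ] EuclideanSpace ℝ (Fin N) => L v) h1).symm.trans h0
    exact hinj (C.proj x) (h2.trans (map_zero _).symm)

end SmoothCone

/-! ### Assembly of the main theorem -/

theorem mainTheorem10
    -- a compact Lie group `G`
    {EG : Type*} [NormedAddCommGroup EG] [NormedSpace ℝ EG] [FiniteDimensional ℝ EG]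
    {G : Type*} [Group G] [TopologicalSpace G] [ChartedSpace EG G] [LieGroup 𝓘(ℝ, EG) ∞ G]
    [T2Space G] [CompactSpace G]
    -- a finite-dimensional smooth manifold `S` (the total space of the cone)
    {ES : Type*} [NormedAddCommGroup ES] [NormedSpace ℝ ES] [FiniteDimensional ℝ ES]
    {HS : Type*} [TopologicalSpace HS] (IS : ModelWithCorners ℝ ES HS)
    {S : Type*} [TopologicalSpace S] [ChartedSpace HS S] [IsManifold IS ∞ S] [T2Space S]
    -- a finite-dimensional compact smooth manifold `X` (the base of the cone)
    {EX : Type*} [NormedAddCommGroup EX] [NormedSpace ℝ EX] [FiniteDimensional ℝ EX]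
    {HX : Type*} [TopologicalSpace HX] (IX : ModelWithCorners ℝ EX HX)
    {X : Type*} [TopologicalSpace X] [ChartedSpace HX X] [IsManifold IX ∞ X] [T2Space X]
    [CompactSpace X]
    -- a `G`-cone: `G` acts smoothly on the cone and commutes with homotheties
    (C : SmoothCone IS IX S X)
    [MulAction G S] [ContMDiffSMul 𝓘(ℝ, EG) IS ∞ G S]
    (hcomm : ∀ (g : G) (t : ℝ), 0 < t → ∀ x : S, g • C.dil t x = C.dil t (g • x))
    -- a `G`-invariant horizontal 1-form, homogeneous of degree 1
    (lam : SmoothOneForm IS S)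
    (hinv : ∀ (g : G) (x : S) (v : TangentSpace IS x),
      pullbackOneForm (fun y : S => g • y) lam x v = lam x v)
    (hhor : C.IsHorizontal lam)
    (hhom : C.HasRadialLieDeriv lam lam) :
    ∃ (n : ℕ) (rep : G →* Matrix.orthogonalGroup (Fin n) ℝ) (z : S → EuclideanSpace ℂ (Fin n)),
      Continuous rep ∧
      IsSmoothEmbeddingInto IS z ∧
      (∀ (g : G) (x : S),
        z (g • x) = Matrix.toEuclideanLin (complexifyRep rep g : Matrix (Fin n) (Fin n) ℂ) (z x)) ∧
      (∀ (t : ℝ), 0 < t → ∀ x : S, z (C.dil t x) = Real.sqrt t • z x) ∧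
      ∀ (x : S) (v : TangentSpace IS x), lam x v = imConjDot IS z x v := by

  let : MeasurableSpace G := borel G
  have : BorelSpace G := ⟨rfl⟩
  have : IsTopologicalGroup G := topologicalGroup_of_lieGroup 𝓘(ℝ, EG) ∞
  have : SecondCountableTopology G := ChartedSpace.secondCountable_of_sigmaCompact EG G
  have : SigmaCompactSpace S := C.sigmaCompactSpace
  -- Haar measure normalized on the compact set `⊤`, that is, with total mass 1.
  let μ : MeasureTheory.Measure G := MeasureTheory.Measure.haarMeasure ⊤
  have : MeasureTheory.IsProbabilityMeasure μ :=
    ⟨MeasureTheory.Measure.haarMeasure_self (K₀ := ⊤)⟩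
  obtain ⟨⟨r₀, hr₀, hr₀pos, hr₀dil⟩, -⟩ := C.exists_degree_one_and_compact
  set r : S → ℝ := orbitIntegral μ (fun _ => 1) r₀ with hrdef
  have hr : ContMDiff IS 𝓘(ℝ, ℝ) ∞ r :=
    contMDiff_orbitIntegral EG μ (MeasureTheory.integrable_const 1) hr₀
  have hr0 : ∀ x, 0 < r x := orbitIntegral_one_pos EG μ hr₀ hr₀pos
  have hr1 : ∀ t, 0 < t → ∀ x, r (C.dil t x) = t * r x := fun t ht x =>
    orbitIntegral_dil μ C hcomm _ ht (hr₀dil t ht) x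
  have hrG : ∀ (g : G) x, r (g • x) = r x := orbitIntegral_one_smul μ r₀
  have hK := C.isCompact_level hr.continuous hr0 hr1
  obtain ⟨N, f, hf, hf0, hfsep, hfimm⟩ := C.exists_degree_zero_injective_immersion hr hr0 hr1
  obtain ⟨d, M, w, hM, hw, hwM, hw0, hsep, himm⟩ :=
    exists_equivariant_injective_immersion EG μ C hcomm hr hr0 hr1 hK hf hf0 hfsep hfimm
  obtain ⟨b, hb, hb1, hbl⟩ := C.exists_homogeneous_coefficients hr hr0 hr1 hw hw0 himm hhor hhom
  obtain ⟨b', hb', hb'1, hb'M, hb'l⟩ :=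
    exists_equivariant_coefficients EG μ C hcomm hinv hM hw hwM hb hb1 hbl
  -- Division of the degree 1 coefficients by the invariant r leaves equivariant functions of degree
  -- 0.
  refine C.exists_complex_embedding (β := fun x => (r x)⁻¹ • b' x) hM hr hr0 hr1 hK hrG hw hw0 hwM
    hsep himm (fun i => (hr.inv₀ fun x => (hr0 x).ne').mul (hb' i)) (fun t ht x => ?_)
    (fun g x => ?_) fun x v => ?_
  · funext i
    have := (hr0 x).ne'
    simp only [Pi.smul_apply, smul_eq_mul, hr1 t ht, hb'1 t ht]
    field_simp
  · simp only [hrG, hb'M, Matrix.mulVec_smul]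
  · simp only [hb'l x v, Pi.smul_apply, smul_eq_mul, mul_assoc, ← Finset.mul_sum]
    rw [mul_inv_cancel_left₀ (hr0 x).ne']
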